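/- Let $\gamma\in(0,1]$, $\beta:=\frac{2}{2-\gamma}$ and $c_\beta:=(2/\beta^2)^{\beta/2}$. For $c\in\mathbb{R}$, an \emph{admissible profile} with speed $c$ is a continuous function $\phi:\mathbb{R}\to[0,\infty)$, neither identically zero nor everywhere positive, which is of class $C^2$ in $\{\phi>0\}$ and satisfies \[ c\phi'+\phi''=\gamma\phi^{\gamma-1}\ \text{ in }\{\phi>0\},\qquad \lim_{\xi\to\xi_0,\ \xi\in\{\phi>0\}}\big|(\phi^{1/\beta})'(\xi)\big|=\frac{\sqrt2}{\beta}\ \text{ for every }\xi_0\in\partial\{\phi>0\}. \] \textbf{Theorem.} For every $c\in\mathbb{R}$ there are admissible profiles $\phi_c^+$ and $\phi_c^-$ with speed $c$ with the following properties. 1. $\phi_c^+=0$ in $(-\infty,0]$, $(\phi_c^+)'>0$ in $(0,\infty)$, and $\phi_c^+(\xi)\to\infty$ as $\xi\to\infty$. Moreover: if $c=0$, then $\phi_0^+(\xi)=c_\beta\,\xi_+^\beta$; if $c>0$, then $\phi_c^+(\xi)\sim\big(\tfrac{2\gamma}{\beta c}\,\xi\big)^{\beta/2}$ as $\xi\to\infty$;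 if $c<0$, then $\phi_c^+(\xi)\sim A\,e^{-c\xi}$ as $\xi\to\infty$ for some constant $A>0$. 2. $\phi_c^-=0$ in $[0,\infty)$, $(\phi_c^-)'<0$ in $(-\infty,0)$, and $\phi_c^-(\xi)\to\infty$ as $\xi\to-\infty$. Moreover: if $c=0$, then $\phi_0^-(\xi)=c_\beta\,(-\xi)_+^\beta$; if $c>0$, then $\phi_c^-(\xi)\sim A\,e^{-c\xi}$ as $\xi\to-\infty$ for some constant $A>0$; if $c<0$, then $\phi_c^-(\xi)\sim\big(\tfrac{2\gamma}{\beta|c|}\,|\xi|\big)^{\beta/2}$ as $\xi\to-\infty$. 3. These are the only two such profiles: $\phi_c^+$ is the only admissible profile with speed $c$ that vanishes in $(-\infty,0]$ and has positive derivative in $(0,\infty)$, and $\phi_c^-$ is the only one that vanishes in $[0,\infty)$ and has negative derivative in $(-\infty,0)$. 4. For every admissible profile $\psi$ with speed $c$ there are $a,b\in\{0,1\}$, not both zero, and $\xi_\pm\in\mathbb{R}$ with $\xi_-\le\xi_+$ such that \[ \psi(\xi)=a\,\phi_c^+(\xi-\xi_+)+b\,\phi_c^-(\xi-\xi_-)\qquad\text{for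 all }\xi\in\mathbb{R}. \] Here $s_+:=\max\{s,0\}$, and $f\sim g$ means $f/g\to1$. -/

import Mathlib

open Set Filter Topology Asymptotics

namespace TravelingWave

/-- The exponent `β = 2 / (2 - γ)`. -/
noncomputable def betaExp (γ : ℝ) : ℝ := 2 / (2 - γ)

/-- The constant `c_β = (2 / β²) ^ (β / 2)`. -/
noncomputable def cBeta (γ : ℝ) : ℝ := (2 / betaExp γ ^ 2) ^ (betaExp γ / 2)

/-- The positivity set `{φ > 0}`. -/
def posSet (φ : ℝ → ℝ) : Set ℝ := {ξ | 0 < φ ξ}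

/-- `φ` is an admissible profile with speed `c`: a continuous nonnegative function on the line,
neither identically zero nor everywhere positive, which is a classical solution of
`c φ' + φ'' = γ φ ^ (γ - 1)` in `{φ > 0}` and such that `|(φ ^ (1 / β))'|` tends to `√2 / β` at
each point of `∂{φ > 0}`, along `{φ > 0}`. -/
structure IsAdmissible (γ c : ℝ) (φ : ℝ → ℝ) : Prop where
  continuous : Continuous φ
  nonneg : ∀ ξ, 0 ≤ φ ξ
  exists_pos : ∃ ξ, 0 < φ ξ
  exists_zero : ∃ ξ, φ ξ = 0
  contDiffOn : ContDiffOn ℝ 2 φ (posSet φ)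
  equation : ∀ ξ ∈ posSet φ, c * deriv φ ξ + deriv (deriv φ) ξ = γ * φ ξ ^ (γ - 1)
  freeBoundary : ∀ ξ₀ ∈ frontier (posSet φ),
    Tendsto (fun ξ => |deriv (fun y => φ y ^ (1 / betaExp γ)) ξ|)
      (𝓝[posSet φ] ξ₀) (𝓝 (√2 / betaExp γ))

/-- `φ = 0` in `(-∞, 0]` and `φ' > 0` in `(0, ∞)`. -/
def IsRightward (φ : ℝ → ℝ) : Prop := (∀ ξ ≤ 0, φ ξ = 0) ∧ ∀ ξ > 0, 0 < deriv φ ξ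

/-- `φ = 0` in `[0, ∞)` and `φ' < 0` in `(-∞, 0)`. -/
def IsLeftward (φ : ℝ → ℝ) : Prop := (∀ ξ ≥ 0, φ ξ = 0) ∧ ∀ ξ < 0, deriv φ ξ < 0

end TravelingWave

namespace TravelingWave

open MeasureTheory

variable {γ c L : ℝ} {φ ψ : ℝ → ℝ}

/-! In the positivity set the equation reads `(e^{cξ} φ')' = γ φ^{γ-1} e^{cξ}`. A profile to the
right of its edge therefore solves a singular initial value problem with `φ(0) = φ'(0) = 0`, that
is, it is a fixed point of `duhamel γ c`. This operator reverses order and is homogeneous of degree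
`γ - 1`, so on functions comparable to `model γ` it contracts `sup |log (φ/ψ)|` by the factor `1 - γ
< 1`; `contractingWith_logDuhamel` yields existence. The same comparison with two speeds,
`IsMild.le_exp_mul`, yields uniqueness. Applied against the explicit solution of speed zero, it
confines `φ/model` at `t` between `e^{-|c|t/γ}` and `e^{|c|t/γ}`, which gives the free boundary
condition. Conversely, that condition makes any half profile asymptotic to the model at its edge,
hence a fixed point (`IsHalfProfile.isMild`).

Growth comes from two monotone or damped quantities: for `c < 0` the function `ψ e^{cξ}` is
nondecreasing and bounded for large `ξ`, and for `c > 0` the function `ψ^{1-γ} ψ'` solves a damped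
linear equation whose forcing tends to `γ`.

For the classification, `φ'' > 0` at every critical point in the positivity set, so there is no
interior maximum and the zero set is an interval. What remains is at most one half-line on each
side. Each carries a translated half profile, the left one after the reflection `ξ ↦ -ξ`, which
changes `c` to `-c`. -/

theorem betaExp_mul_two_sub (hγ : γ ∈ Ioc (0 : ℝ) 1) : betaExp γ * (2 - γ) = 2 := by
  have : 2 - γ ≠ 0 := by linarith [hγ.2]
  rw [betaExp]; field_simp

theorem one_lt_betaExp (hγ : γ ∈ Ioc (0 : ℝ) 1) : 1 < betaExp γ := by
  rw [betaExp, lt_div_iff₀] <;> linarith [hγ.1, hγ.2]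

theorem betaExp_pos (hγ : γ ∈ Ioc (0 : ℝ) 1) : 0 < betaExp γ :=
  zero_lt_one.trans (one_lt_betaExp hγ)

theorem cBeta_pos (hγ : γ ∈ Ioc (0 : ℝ) 1) : 0 < cBeta γ := by
  have := betaExp_pos hγ
  unfold cBeta; positivity

theorem cBeta_rpow_inv (hγ : γ ∈ Ioc (0 : ℝ) 1) :
    cBeta γ ^ (1 / betaExp γ) = √2 / betaExp γ := by
  have h := betaExp_pos hγ
  rw [cBeta, ← Real.rpow_mul (by positivity), show betaExp γ / 2 * (1 / betaExp γ) = 1 / 2 by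
    field_simp, ← Real.sqrt_eq_rpow, Real.sqrt_div (by norm_num), Real.sqrt_sq h.le]

/-- This is the coefficient identity making `c_β s^β` a solution of `φ'' = γ φ^{γ-1}`; it rests on
`c_β^{2-γ} = 2/β²`. -/
theorem cBeta_rpow_sub_one (hγ : γ ∈ Ioc (0 : ℝ) 1) :
    γ * cBeta γ ^ (γ - 1) = cBeta γ * betaExp γ * (betaExp γ - 1) := by
  have h := betaExp_pos hγ
  have hm := betaExp_mul_two_sub hγ
  have hc := cBeta_pos hγ
  have h1 : cBeta γ ^ (2 - γ) = 2 / betaExp γ ^ 2 := by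
    rw [cBeta, ← Real.rpow_mul (by positivity), show betaExp γ / 2 * (2 - γ) = 1 by linarith,
      Real.rpow_one]
  have h2 : cBeta γ ^ (γ - 1) * cBeta γ ^ (2 - γ) = cBeta γ := by
    rw [← Real.rpow_add hc, show γ - 1 + (2 - γ) = 1 by ring, Real.rpow_one]
  rw [h1] at h2
  have h3 : cBeta γ ^ (γ - 1) = cBeta γ * betaExp γ ^ 2 / 2 := by
    field_simp at h2 ⊢; linarith
  rw [h3]
  have h4 : γ * betaExp γ = 2 * (betaExp γ - 1) := by linarith
  calc γ * (cBeta γ * betaExp γ ^ 2 / 2) = (γ * betaExp γ) * (cBeta γ * betaExp γ / 2) := by ring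
    _ = _ := by rw [h4]; ring

/-! ### The model profile and the integral operator -/

/-- The profile `c_β s ^ β` of speed zero. -/
noncomputable def model (γ s : ℝ) : ℝ := cBeta γ * s ^ betaExp γ

/-- The derivative at `t` of the solution of `c p' + p'' = γ φ ^ (γ - 1)`, `p 0 = p' 0 = 0`. -/
noncomputable def flux (γ c : ℝ) (φ : ℝ → ℝ) (t : ℝ) : ℝ :=
  ∫ s in (0 : ℝ)..t, γ * φ s ^ (γ - 1) * Real.exp (-c * (t - s))

/-- The solution of `c p' + p'' = γ φ ^ (γ - 1)`, `p 0 = p' 0 = 0`. -/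
noncomputable def duhamel (γ c : ℝ) (φ : ℝ → ℝ) (ξ : ℝ) : ℝ :=
  ∫ t in (0 : ℝ)..ξ, flux γ c φ t

theorem model_pos (hγ : γ ∈ Ioc (0 : ℝ) 1) {s : ℝ} (hs : 0 < s) : 0 < model γ s :=
  mul_pos (cBeta_pos hγ) (Real.rpow_pos_of_pos hs _)

theorem continuous_model (hγ : γ ∈ Ioc (0 : ℝ) 1) : Continuous (model γ) :=
  continuous_const.mul (Real.continuous_rpow_const (betaExp_pos hγ).le)

theorem model_source (hγ : γ ∈ Ioc (0 : ℝ) 1) {s : ℝ} (hs : 0 < s) :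
    γ * model γ s ^ (γ - 1) = cBeta γ * betaExp γ * (betaExp γ - 1) * s ^ (betaExp γ - 2) := by
  have hm := betaExp_mul_two_sub hγ
  rw [model, Real.mul_rpow (cBeta_pos hγ).le (Real.rpow_pos_of_pos hs _).le, ← Real.rpow_mul hs.le,
    ← mul_assoc, cBeta_rpow_sub_one hγ, show betaExp γ * (γ - 1) = betaExp γ - 2 by linarith]

/-! ### Functions comparable to the model -/

/-- A continuous function on `(0, L]` between two positive multiples of the model profile. -/
structure ModelLike (γ L : ℝ) (φ : ℝ → ℝ) : Prop where
  continuousOn : ContinuousOn φ (Ioc 0 L)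
  bound : ∃ m, ∀ s ∈ Ioc 0 L, model γ s ≤ Real.exp m * φ s ∧ φ s ≤ Real.exp m * model γ s

theorem ModelLike.pos (hγ : γ ∈ Ioc (0 : ℝ) 1) (h : ModelLike γ L φ) {s : ℝ} (hs : s ∈ Ioc 0 L) :
    0 < φ s := by
  obtain ⟨m, hm⟩ := h.bound
  exact pos_of_mul_pos_right ((model_pos hγ hs.1).trans_le (hm s hs).1) (Real.exp_pos m).le

theorem ModelLike.mono (h : ModelLike γ L φ) {l : ℝ} (hl : l ≤ L) : ModelLike γ l φ :=
  ⟨h.continuousOn.mono (Ioc_subset_Ioc_right hl),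
    h.bound.imp fun _ hm s hs => hm s (Ioc_subset_Ioc_right hl hs)⟩

theorem ModelLike.congr (h : ModelLike γ L φ) (he : ∀ s ∈ Ioc 0 L, ψ s = φ s) :
    ModelLike γ L ψ :=
  ⟨h.continuousOn.congr he, h.bound.imp fun m hm s hs => by rw [he s hs]; exact hm s hs⟩

theorem modelLike_model (hγ : γ ∈ Ioc (0 : ℝ) 1) (L : ℝ) : ModelLike γ L (model γ) :=
  ⟨(continuous_model hγ).continuousOn, 0, by simp⟩

/-- The power `γ - 1 ≤ 0` reverses inequalities up to a factor. -/
theorem rpow_sub_one_le (hγ : γ ∈ Ioc (0 : ℝ) 1) {x y m : ℝ} (hx : 0 < x) (hy : 0 < y)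
    (h : y ≤ Real.exp m * x) : x ^ (γ - 1) ≤ Real.exp ((1 - γ) * m) * y ^ (γ - 1) := by
  have h1 := Real.rpow_le_rpow_of_nonpos hy h (by linarith [hγ.2] : γ - 1 ≤ 0)
  rw [Real.mul_rpow (Real.exp_pos m).le hx.le, ← Real.exp_mul] at h1
  calc x ^ (γ - 1) = Real.exp ((1 - γ) * m) * (Real.exp (m * (γ - 1)) * x ^ (γ - 1)) := by
        rw [← mul_assoc, ← Real.exp_add, show (1 - γ) * m + m * (γ - 1) = 0 by ring, Real.exp_zero,
          one_mul]
    _ ≤ _ := by gcongr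

/-- The source is dominated by a multiple of `s^{β-2}`, integrable at `0` because `β > 1`. -/
theorem ModelLike.intervalIntegrable_rpow (hγ : γ ∈ Ioc (0 : ℝ) 1) (h : ModelLike γ L φ)
    (hL : 0 ≤ L) : IntervalIntegrable (fun s => φ s ^ (γ - 1)) volume 0 L := by
  obtain ⟨m, hm⟩ := h.bound
  have hb := one_lt_betaExp hγ
  have hI : IntervalIntegrable (fun s : ℝ => Real.exp ((1 - γ) * m) *
      (cBeta γ * betaExp γ * (betaExp γ - 1) / γ * s ^ (betaExp γ - 2))) volume 0 L :=
    ((intervalIntegral.intervalIntegrable_rpow' (by linarith)).const_mul _).const_mul _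
  refine hI.mono_fun ?_ ?_
  · rw [uIoc_of_le hL]
    refine ContinuousOn.aestronglyMeasurable ?_ measurableSet_Ioc
    exact h.continuousOn.rpow_const fun s hs => Or.inl (h.pos hγ hs).ne'
  · rw [uIoc_of_le hL]
    filter_upwards [ae_restrict_mem measurableSet_Ioc] with s hs
    have hp := h.pos hγ hs
    have h1 := rpow_sub_one_le hγ hp (model_pos hγ hs.1) (hm s hs).1
    have h2 : model γ s ^ (γ - 1) =
        cBeta γ * betaExp γ * (betaExp γ - 1) / γ * s ^ (betaExp γ - 2) := by
      have := model_source hγ hs.1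
      have h0 := hγ.1.ne'
      field_simp
      linarith
    rw [h2] at h1
    rw [Real.norm_of_nonneg (Real.rpow_pos_of_pos hp _).le]
    exact h1.trans (le_abs_self _)

theorem ModelLike.intervalIntegrable_source (hγ : γ ∈ Ioc (0 : ℝ) 1) (h : ModelLike γ L φ)
    (hL : 0 ≤ L) {w : ℝ → ℝ} (hw : Continuous w) :
    IntervalIntegrable (fun s => γ * φ s ^ (γ - 1) * w s) volume 0 L :=
  ((h.intervalIntegrable_rpow hγ hL).const_mul γ).mul_continuousOn hw.continuousOn

/-! ### Regularity of the integral operator -/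

theorem flux_eq (γ c : ℝ) (φ : ℝ → ℝ) (t : ℝ) : flux γ c φ t =
    Real.exp (-c * t) * ∫ s in (0 : ℝ)..t, γ * φ s ^ (γ - 1) * Real.exp (c * s) := by
  rw [flux, ← intervalIntegral.integral_const_mul]
  congr 1; ext s
  rw [show -c * (t - s) = -c * t + c * s by ring, Real.exp_add]; ring

theorem ModelLike.continuousOn_flux (hγ : γ ∈ Ioc (0 : ℝ) 1) (h : ModelLike γ L φ)
    (hL : 0 ≤ L) : ContinuousOn (flux γ c φ) (Icc 0 L) := by
  simp only [funext (flux_eq γ c φ)]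
  refine ContinuousOn.mul (by fun_prop) ?_
  have := intervalIntegral.continuousOn_primitive_interval'
    (h.intervalIntegrable_source hγ hL (w := fun s => Real.exp (c * s)) (by fun_prop))
    (left_mem_uIcc)
  rwa [uIcc_of_le hL] at this

theorem ModelLike.intervalIntegrable_flux (hγ : γ ∈ Ioc (0 : ℝ) 1) (h : ModelLike γ L φ)
    (hL : 0 ≤ L) : IntervalIntegrable (flux γ c φ) volume 0 L :=
  ContinuousOn.intervalIntegrable (by rw [uIcc_of_le hL]; exact h.continuousOn_flux hγ hL)

theorem ModelLike.hasDerivAt_flux (hγ : γ ∈ Ioc (0 : ℝ) 1) (h : ModelLike γ L φ) {t : ℝ}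
    (ht : t ∈ Ioo 0 L) :
    HasDerivAt (flux γ c φ) (γ * φ t ^ (γ - 1) - c * flux γ c φ t) t := by
  have hw : Continuous fun s => Real.exp (c * s) := by fun_prop
  have hc : ContinuousOn (fun s => γ * φ s ^ (γ - 1) * Real.exp (c * s)) (Ioo 0 L) := by
    refine ContinuousOn.mul (ContinuousOn.mul continuousOn_const ?_) hw.continuousOn
    exact (h.continuousOn.mono Ioo_subset_Ioc_self).rpow_const
      fun s hs => Or.inl (h.pos hγ (Ioo_subset_Ioc_self hs)).ne'
  have h1 := intervalIntegral.integral_hasDerivAt_right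
    ((h.mono ht.2.le).intervalIntegrable_source hγ ht.1.le hw)
    (hc.stronglyMeasurableAtFilter isOpen_Ioo t ht) (hc.continuousAt (Ioo_mem_nhds ht.1 ht.2))
  have h2 : HasDerivAt (fun t => Real.exp (-c * t)) (Real.exp (-c * t) * -c) t := by
    simpa using ((hasDerivAt_id t).const_mul (-c)).exp
  have h3 := h2.mul h1
  rw [show flux γ c φ = _ from funext (flux_eq γ c φ)]
  have : Real.exp (-c * t) * Real.exp (c * t) = 1 := by
    rw [← Real.exp_add]; simp
  refine h3.congr_deriv ?_
  linear_combination (γ * φ t ^ (γ - 1)) * this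

theorem ModelLike.hasDerivAt_duhamel (hγ : γ ∈ Ioc (0 : ℝ) 1) (h : ModelLike γ L φ) {t : ℝ}
    (ht : t ∈ Ioo 0 L) : HasDerivAt (duhamel γ c φ) (flux γ c φ t) t := by
  have hL := (ht.1.trans ht.2).le
  have hc : ContinuousOn (flux γ c φ) (Ioo 0 L) :=
    (h.continuousOn_flux hγ hL).mono Ioo_subset_Icc_self
  exact intervalIntegral.integral_hasDerivAt_right
    ((h.mono ht.2.le).intervalIntegrable_flux hγ ht.1.le)
    (hc.stronglyMeasurableAtFilter isOpen_Ioo t ht) (hc.continuousAt (Ioo_mem_nhds ht.1 ht.2))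

theorem ModelLike.continuousOn_duhamel (hγ : γ ∈ Ioc (0 : ℝ) 1) (h : ModelLike γ L φ)
    (hL : 0 ≤ L) : ContinuousOn (duhamel γ c φ) (Icc 0 L) := by
  have := intervalIntegral.continuousOn_primitive_interval'
    (h.intervalIntegrable_flux (c := c) hγ hL) (left_mem_uIcc)
  rwa [uIcc_of_le hL] at this

/-! ### Comparison of the operators and the explicit fixed point -/

theorem flux_congr {t : ℝ} (ht : 0 ≤ t) (he : ∀ s ∈ Ioc 0 t, ψ s = φ s) :
    flux γ c ψ t = flux γ c φ t := by
  refine intervalIntegral.integral_congr_uIoo fun s hs => ?_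
  rw [uIoo_of_le ht] at hs
  simp only [he s (Ioo_subset_Ioc_self hs)]

theorem duhamel_congr {ξ : ℝ} (hξ : 0 ≤ ξ) (he : ∀ s ∈ Ioc 0 ξ, ψ s = φ s) :
    duhamel γ c ψ ξ = duhamel γ c φ ξ := by
  refine intervalIntegral.integral_congr_uIoo fun t ht => ?_
  rw [uIoo_of_le hξ] at ht
  exact flux_congr ht.1.le fun s hs => he s ⟨hs.1, hs.2.trans ht.2.le⟩

/-- Since `γ - 1 ≤ 0`, an upper bound for `φ₂` by `φ₁` turns into an upper bound for the flux of
`φ₁`, with `m` shrunk to `(1 - γ) m`. Changing the speed in the kernel costs the additional `|c₁ -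
c₂| L`. -/
theorem flux_le_flux (hγ : γ ∈ Ioc (0 : ℝ) 1) {c₁ c₂ m t : ℝ} {φ₁ φ₂ : ℝ → ℝ}
    (h₁ : ModelLike γ L φ₁) (h₂ : ModelLike γ L φ₂)
    (hle : ∀ s ∈ Ioc 0 L, φ₂ s ≤ Real.exp m * φ₁ s) (ht : t ∈ Icc 0 L) :
    flux γ c₁ φ₁ t ≤ Real.exp (|c₁ - c₂| * L + (1 - γ) * m) * flux γ c₂ φ₂ t := by
  rw [flux, flux, ← intervalIntegral.integral_const_mul]
  refine intervalIntegral.integral_mono_on_of_le_Ioo ht.1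
    ((h₁.mono ht.2).intervalIntegrable_source hγ ht.1 (by fun_prop))
    (((h₂.mono ht.2).intervalIntegrable_source hγ ht.1 (by fun_prop)).const_mul _) fun s hs => ?_
  have hs' : s ∈ Ioc 0 L := ⟨hs.1, hs.2.le.trans ht.2⟩
  have hp₂ := h₂.pos hγ hs'
  have e1 := rpow_sub_one_le hγ (h₁.pos hγ hs') hp₂ (hle s hs')
  have e2 : Real.exp (-c₁ * (t - s)) ≤
      Real.exp (|c₁ - c₂| * L) * Real.exp (-c₂ * (t - s)) := by
    rw [← Real.exp_add, Real.exp_le_exp]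
    have : -(c₁ - c₂) * (t - s) ≤ |c₁ - c₂| * L :=
      mul_le_mul (neg_le_abs _) (by linarith [hs.1, ht.2]) (by linarith [hs.2]) (abs_nonneg _)
    linarith
  have := hγ.1
  calc γ * φ₁ s ^ (γ - 1) * Real.exp (-c₁ * (t - s))
      ≤ γ * (Real.exp ((1 - γ) * m) * φ₂ s ^ (γ - 1)) *
        (Real.exp (|c₁ - c₂| * L) * Real.exp (-c₂ * (t - s))) := by
        gcongr
    _ = _ := by rw [Real.exp_add]; ring

theorem duhamel_le_duhamel (hγ : γ ∈ Ioc (0 : ℝ) 1) {c₁ c₂ m ξ : ℝ} {φ₁ φ₂ : ℝ → ℝ}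
    (h₁ : ModelLike γ L φ₁) (h₂ : ModelLike γ L φ₂)
    (hle : ∀ s ∈ Ioc 0 L, φ₂ s ≤ Real.exp m * φ₁ s) (hξ : ξ ∈ Icc 0 L) :
    duhamel γ c₁ φ₁ ξ ≤ Real.exp (|c₁ - c₂| * L + (1 - γ) * m) * duhamel γ c₂ φ₂ ξ := by
  rw [duhamel, duhamel, ← intervalIntegral.integral_const_mul]
  exact intervalIntegral.integral_mono_on hξ.1 ((h₁.mono hξ.2).intervalIntegrable_flux hγ hξ.1)
    (((h₂.mono hξ.2).intervalIntegrable_flux hγ hξ.1).const_mul _)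
    fun t ht => flux_le_flux hγ h₁ h₂ hle ⟨ht.1, ht.2.trans hξ.2⟩

theorem flux_model (hγ : γ ∈ Ioc (0 : ℝ) 1) {t : ℝ} (ht : 0 ≤ t) :
    flux γ 0 (model γ) t = cBeta γ * betaExp γ * t ^ (betaExp γ - 1) := by
  have hb := one_lt_betaExp hγ
  have hb' : betaExp γ - 1 ≠ 0 := by linarith
  have : flux γ 0 (model γ) t = ∫ s in (0 : ℝ)..t,
      cBeta γ * betaExp γ * (betaExp γ - 1) * s ^ (betaExp γ - 2) := by
    refine intervalIntegral.integral_congr_uIoo fun s hs => ?_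
    rw [uIoo_of_le ht] at hs
    simp [model_source hγ hs.1]
  rw [this, intervalIntegral.integral_const_mul, integral_rpow (Or.inl (by linarith)),
    show betaExp γ - 2 + 1 = betaExp γ - 1 by ring, Real.zero_rpow hb']
  field_simp
  ring

theorem duhamel_model (hγ : γ ∈ Ioc (0 : ℝ) 1) {ξ : ℝ} (hξ : 0 ≤ ξ) :
    duhamel γ 0 (model γ) ξ = model γ ξ := by
  have hb := one_lt_betaExp hγ
  have hb' := (betaExp_pos hγ).ne'
  have : duhamel γ 0 (model γ) ξ = ∫ s in (0 : ℝ)..ξ,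
      cBeta γ * betaExp γ * s ^ (betaExp γ - 1) := by
    refine intervalIntegral.integral_congr_uIoo fun s hs => ?_
    rw [uIoo_of_le hξ] at hs
    exact flux_model hγ hs.1.le
  rw [this, intervalIntegral.integral_const_mul, integral_rpow (Or.inl (by linarith)),
    show betaExp γ - 1 + 1 = betaExp γ by ring, Real.zero_rpow hb', model]
  field_simp
  ring

/-! ### Mild solutions: dependence on the speed and uniqueness -/

/-- `φ` solves the integrated initial value problem on `(0, L]`. -/
structure IsMild (γ c L : ℝ) (φ : ℝ → ℝ) : Prop extends ModelLike γ L φ where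
  eq_duhamel : ∀ ξ ∈ Ioc 0 L, φ ξ = duhamel γ c φ ξ

theorem IsMild.mono (h : IsMild γ c L φ) {l : ℝ} (hl : l ≤ L) : IsMild γ c l φ :=
  ⟨h.toModelLike.mono hl, fun ξ hξ => h.eq_duhamel ξ (Ioc_subset_Ioc_right hl hξ)⟩

theorem IsMild.congr (h : IsMild γ c L φ) (he : ∀ s ∈ Ioc 0 L, ψ s = φ s) : IsMild γ c L ψ :=
  ⟨h.toModelLike.congr he, fun ξ hξ => by
    rw [he ξ hξ, h.eq_duhamel ξ hξ]
    exact (duhamel_congr hξ.1.le fun s hs => he s ⟨hs.1, hs.2.trans hξ.2⟩).symm⟩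

theorem isMild_model (hγ : γ ∈ Ioc (0 : ℝ) 1) (L : ℝ) : IsMild γ 0 L (model γ) :=
  ⟨modelLike_model hγ L, fun _ hξ => (duhamel_model hγ hξ.1.le).symm⟩

theorem ModelLike.exists_le (h₁ : ModelLike γ L φ) (h₂ : ModelLike γ L ψ) :
    ∃ m, ∀ s ∈ Ioc 0 L, φ s ≤ Real.exp m * ψ s := by
  obtain ⟨m₁, h₁⟩ := h₁.bound
  obtain ⟨m₂, h₂⟩ := h₂.bound
  refine ⟨m₁ + m₂, fun s hs => ?_⟩
  rw [Real.exp_add, mul_assoc]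
  exact (h₁ s hs).2.trans (by have := (h₂ s hs).1; gcongr)

/-- Comparability to the model supplies some finite exponent. Applying the operator to both
functions improves it repeatedly, and the limit of the iteration no longer depends on the initial
exponent. -/
theorem IsMild.le_exp_mul (hγ : γ ∈ Ioc (0 : ℝ) 1) {c₁ c₂ : ℝ} {φ₁ φ₂ : ℝ → ℝ}
    (h₁ : IsMild γ c₁ L φ₁) (h₂ : IsMild γ c₂ L φ₂) {ξ : ℝ} (hξ : ξ ∈ Ioc 0 L) :
    φ₁ ξ ≤ Real.exp (|c₁ - c₂| * L / γ) * φ₂ ξ := by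
  obtain ⟨m₁, hm₁⟩ := h₁.toModelLike.exists_le h₂.toModelLike
  obtain ⟨m₂, hm₂⟩ := h₂.toModelLike.exists_le h₁.toModelLike
  set κ := |c₁ - c₂| * L with hκ
  have hκ' : |c₂ - c₁| * L = κ := by rw [hκ, abs_sub_comm]
  have hγ0 := hγ.1.ne'
  set m := max m₁ m₂
  -- This is the closed form of the iteration `m ↦ κ + (1 - γ) m`, whose fixed point is `κ / γ`.
  have key : ∀ n : ℕ, ∀ s ∈ Ioc 0 L,
      φ₁ s ≤ Real.exp (κ / γ + (1 - γ) ^ n * (m - κ / γ)) * φ₂ s ∧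
      φ₂ s ≤ Real.exp (κ / γ + (1 - γ) ^ n * (m - κ / γ)) * φ₁ s := by
    intro n
    induction n with
    | zero =>
      intro s hs
      have p1 := h₁.toModelLike.pos hγ hs
      have p2 := h₂.toModelLike.pos hγ hs
      rw [pow_zero, one_mul, add_sub_cancel]
      exact ⟨(hm₁ s hs).trans (by gcongr; exact le_max_left _ _),
        (hm₂ s hs).trans (by gcongr; exact le_max_right _ _)⟩
    | succ n ih =>
      intro s hs
      have hs' := Ioc_subset_Icc_self hs
      have e : κ / γ + (1 - γ) ^ (n + 1) * (m - κ / γ) =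
          κ + (1 - γ) * (κ / γ + (1 - γ) ^ n * (m - κ / γ)) := by
        field_simp; ring
      rw [e]
      constructor
      · rw [h₁.eq_duhamel s hs, h₂.eq_duhamel s hs]
        exact duhamel_le_duhamel hγ h₁.toModelLike h₂.toModelLike (fun s hs => (ih s hs).2) hs'
      · rw [h₁.eq_duhamel s hs, h₂.eq_duhamel s hs, ← hκ']
        exact duhamel_le_duhamel hγ h₂.toModelLike h₁.toModelLike
          (fun s hs => by rw [hκ']; exact (ih s hs).1) hs'
  have hlim : Tendsto (fun n : ℕ => Real.exp (κ / γ + (1 - γ) ^ n * (m - κ / γ)) * φ₂ ξ) atTop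
      (𝓝 (Real.exp (κ / γ + 0 * (m - κ / γ)) * φ₂ ξ)) := by
    have := tendsto_pow_atTop_nhds_zero_of_lt_one (r := 1 - γ) (by linarith [hγ.2])
      (by linarith [hγ.1])
    exact ((Real.continuous_exp.tendsto _).comp ((this.mul_const _).const_add _)).mul_const _
  rw [zero_mul, add_zero] at hlim
  exact ge_of_tendsto' hlim fun n => (key n ξ hξ).1

theorem IsMild.unique (hγ : γ ∈ Ioc (0 : ℝ) 1) (h₁ : IsMild γ c L φ) (h₂ : IsMild γ c L ψ)
    {ξ : ℝ} (hξ : ξ ∈ Ioc 0 L) : φ ξ = ψ ξ := by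
  have e1 := h₁.le_exp_mul hγ h₂ hξ
  have e2 := h₂.le_exp_mul hγ h₁ hξ
  simp only [sub_self, abs_zero, zero_mul, zero_div, Real.exp_zero, one_mul] at e1 e2
  exact le_antisymm e1 e2

/-- The exponent `κ / γ` is fixed by `m ↦ κ + (1 - γ) m`, so derivatives obey the same bound as the
solutions. -/
theorem IsMild.flux_le_exp_mul (hγ : γ ∈ Ioc (0 : ℝ) 1) {c₁ c₂ : ℝ} {φ₁ φ₂ : ℝ → ℝ}
    (h₁ : IsMild γ c₁ L φ₁) (h₂ : IsMild γ c₂ L φ₂) {t : ℝ} (ht : t ∈ Icc 0 L) :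
    flux γ c₁ φ₁ t ≤ Real.exp (|c₁ - c₂| * L / γ) * flux γ c₂ φ₂ t := by
  have hγ0 := hγ.1.ne'
  have := flux_le_flux (c₁ := c₁) (c₂ := c₂) (m := |c₁ - c₂| * L / γ) hγ h₁.toModelLike
    h₂.toModelLike (fun s hs => by rw [abs_sub_comm]; exact h₂.le_exp_mul hγ h₁ hs) ht
  rwa [show |c₁ - c₂| * L + (1 - γ) * (|c₁ - c₂| * L / γ) = |c₁ - c₂| * L / γ by
    field_simp; ring] at this

/-! ### Existence by contraction in logarithmic coordinates -/

theorem ModelLike.duhamel (hγ : γ ∈ Ioc (0 : ℝ) 1) (h : ModelLike γ L φ) (c : ℝ) :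
    ModelLike γ L (duhamel γ c φ) := by
  rcases le_or_gt L 0 with hL | hL
  · simpa [Ioc_eq_empty hL.not_gt] using (⟨by simp [Ioc_eq_empty hL.not_gt],
      0, by simp [Ioc_eq_empty hL.not_gt]⟩ : ModelLike γ L (TravelingWave.duhamel γ c φ))
  obtain ⟨m, hm⟩ := h.bound
  refine ⟨(h.continuousOn_duhamel hγ hL.le).mono Ioc_subset_Icc_self,
    |c| * L + (1 - γ) * m, fun s hs => ?_⟩
  -- The model is its own image at speed zero, so both bounds follow by comparing images with it.
  have h0 := modelLike_model hγ L
  have e1 := duhamel_le_duhamel (c₁ := 0) (c₂ := c) hγ h0 h (fun s hs => (hm s hs).2)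
    (Ioc_subset_Icc_self hs)
  have e2 := duhamel_le_duhamel (c₁ := c) (c₂ := 0) hγ h h0 (fun s hs => (hm s hs).1)
    (Ioc_subset_Icc_self hs)
  rw [duhamel_model hγ hs.1.le] at e1 e2
  simp only [zero_sub, abs_neg, sub_zero] at e1 e2
  exact ⟨e1, e2⟩

/-- The profile whose logarithmic distance to the model is `g ∘ log`. -/
noncomputable def ofLog (γ : ℝ) (g : ℝ → ℝ) (s : ℝ) : ℝ := model γ s * Real.exp (g (Real.log s))

open BoundedContinuousFunction in
theorem modelLike_ofLog (hγ : γ ∈ Ioc (0 : ℝ) 1) (L : ℝ) (g : ℝ →ᵇ ℝ) :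
    ModelLike γ L (ofLog γ g) := by
  refine ⟨?_, ‖g‖, fun s hs => ?_⟩
  · refine (continuous_model hγ).continuousOn.mul (Real.continuous_exp.comp_continuousOn
      (g.continuous.comp_continuousOn (Real.continuousOn_log.mono fun s hs => ?_)))
    exact hs.1.ne'
  · have hg := abs_le.1 (g.norm_coe_le_norm (Real.log s))
    have hp := model_pos hγ hs.1
    unfold ofLog
    constructor
    · rw [mul_left_comm, ← Real.exp_add]
      exact le_mul_of_one_le_right hp.le (Real.one_le_exp (by linarith [hg.1]))
    · rw [mul_comm]
      gcongr
      exact hg.2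

theorem ModelLike.continuous_log (hγ : γ ∈ Ioc (0 : ℝ) 1) (hL : 0 < L) (h : ModelLike γ L φ) :
    Continuous fun x => Real.log (φ (min (Real.exp x) L) / model γ (min (Real.exp x) L)) := by
  have hmem : ∀ x, min (Real.exp x) L ∈ Ioc 0 L := fun x =>
    ⟨lt_min (Real.exp_pos x) hL, min_le_right _ _⟩
  have hc : Continuous fun x => min (Real.exp x) L := by fun_prop
  refine Continuous.log ?_ fun x =>
    (div_pos (h.pos hγ (hmem x)) (model_pos hγ (hmem x).1)).ne'
  exact (h.continuousOn.comp_continuous hc hmem).div₀ ((continuous_model hγ).comp hc)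
    fun x => (model_pos hγ (hmem x).1).ne'

theorem abs_log_sub_log_le {x y m : ℝ} (hx : 0 < x) (hy : 0 < y) (h₁ : x ≤ Real.exp m * y)
    (h₂ : y ≤ Real.exp m * x) : |Real.log x - Real.log y| ≤ m := by
  have e1 := Real.log_le_log hx h₁
  have e2 := Real.log_le_log hy h₂
  rw [Real.log_mul (Real.exp_pos m).ne' (by positivity), Real.log_exp] at e1 e2
  rw [abs_le]; constructor <;> linarith

open BoundedContinuousFunction in
/-- The Duhamel operator in logarithmic coordinates. -/
noncomputable def logDuhamel (hγ : γ ∈ Ioc (0 : ℝ) 1) (c : ℝ) (hL : 0 < L) (g : ℝ →ᵇ ℝ) :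
    ℝ →ᵇ ℝ :=
  BoundedContinuousFunction.ofNormedAddCommGroup
    -- The variable is `x = log s`; capping `s` at `L` freezes the function beyond `log L`, so that
    -- it lives on the whole line.
    (fun x => Real.log (duhamel γ c (ofLog γ g) (min (Real.exp x) L) /
      model γ (min (Real.exp x) L)))
    (((modelLike_ofLog hγ L g).duhamel hγ c).continuous_log hγ hL)
    ((modelLike_ofLog hγ L g).duhamel hγ c).bound.choose
    (fun x => by
      have h := (modelLike_ofLog hγ L g).duhamel hγ c
      have hmem : min (Real.exp x) L ∈ Ioc 0 L := ⟨lt_min (Real.exp_pos x) hL, min_le_right _ _⟩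
      have hb := h.bound.choose_spec _ hmem
      have hp := h.pos hγ hmem
      have hq := model_pos hγ hmem.1
      rw [Real.log_div hp.ne' hq.ne']
      exact abs_log_sub_log_le hp hq hb.2 hb.1)

open BoundedContinuousFunction in
-- The uniform distance of `g₁` and `g₂` serves as the exponent `m` in `duhamel_le_duhamel`; with
-- equal speeds it is multiplied by `1 - γ`.
theorem contractingWith_logDuhamel (hγ : γ ∈ Ioc (0 : ℝ) 1) (c : ℝ) (hL : 0 < L) :
    ContractingWith (1 - γ).toNNReal (logDuhamel hγ c hL) := by
  refine ⟨by rw [Real.toNNReal_lt_one]; linarith [hγ.1],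
    LipschitzWith.of_dist_le_mul fun g₁ g₂ => ?_⟩
  rw [Real.coe_toNNReal _ (sub_nonneg.2 hγ.2)]
  have hle : ∀ g₁ g₂ : ℝ →ᵇ ℝ, ∀ s ∈ Ioc 0 L,
      ofLog γ g₁ s ≤ Real.exp (dist g₁ g₂) * ofLog γ g₂ s := by
    intro g₁ g₂ s hs
    have hd := (abs_le.1 (dist_coe_le_dist (f := g₁) (g := g₂) (Real.log s))).2
    unfold ofLog
    rw [mul_left_comm, ← Real.exp_add]
    have := model_pos hγ hs.1
    gcongr
    linarith
  refine (dist_le (by have := hγ.2; exact mul_nonneg (sub_nonneg.2 this) dist_nonneg)).2 fun x => ?_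
  have hmem : min (Real.exp x) L ∈ Ioc 0 L := ⟨lt_min (Real.exp_pos x) hL, min_le_right _ _⟩
  have h₁ := modelLike_ofLog hγ L g₁
  have h₂ := modelLike_ofLog hγ L g₂
  have p1 := (h₁.duhamel hγ c).pos hγ hmem
  have p2 := (h₂.duhamel hγ c).pos hγ hmem
  have hq := model_pos hγ hmem.1
  have e1 := duhamel_le_duhamel (c₁ := c) (c₂ := c) hγ h₁ h₂ (hle g₂ g₁) (Ioc_subset_Icc_self hmem)
  have e2 := duhamel_le_duhamel (c₁ := c) (c₂ := c) hγ h₂ h₁ (hle g₁ g₂) (Ioc_subset_Icc_self hmem)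
  rw [dist_comm g₂ g₁] at e1
  simp only [sub_self, abs_zero, zero_mul, zero_add] at e1 e2
  change |Real.log _ - Real.log _| ≤ (1 - γ) * _
  rw [Real.log_div p1.ne' hq.ne', Real.log_div p2.ne' hq.ne', sub_sub_sub_cancel_right]
  exact abs_log_sub_log_le p1 p2 e1 e2

theorem exists_isMild (hγ : γ ∈ Ioc (0 : ℝ) 1) (c : ℝ) (hL : 0 < L) : ∃ φ, IsMild γ c L φ := by
  have hS := contractingWith_logDuhamel hγ c hL
  set g := hS.fixedPoint (logDuhamel hγ c hL)
  have hg : logDuhamel hγ c hL g = g := hS.fixedPoint_isFixedPt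
  refine ⟨ofLog γ g, modelLike_ofLog hγ L g, fun ξ hξ => ?_⟩
  have hp := ((modelLike_ofLog hγ L g).duhamel hγ c).pos hγ hξ
  have hq := model_pos hγ hξ.1
  have e : g (Real.log ξ) = Real.log (duhamel γ c (ofLog γ g) ξ / model γ ξ) := by
    conv_lhs => rw [← hg]
    change Real.log (duhamel γ c (ofLog γ g) (min (Real.exp (Real.log ξ)) L) /
      model γ (min (Real.exp (Real.log ξ)) L)) = _
    rw [Real.exp_log hξ.1, min_eq_left hξ.2]
  conv_lhs => rw [ofLog, e, Real.exp_log (div_pos hp hq)]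
  field_simp

theorem exists_isMild_forall (hγ : γ ∈ Ioc (0 : ℝ) 1) (c : ℝ) :
    ∃ φ : ℝ → ℝ, (∀ ξ ≤ 0, φ ξ = 0) ∧ ∀ L > 0, IsMild γ c L φ := by
  choose! Φ hΦ using fun (L : ℝ) (hL : 0 < L) => exists_isMild hγ c hL
  -- The diagonal `Φ ξ ξ` glues the solutions on the intervals `(0, L]`, which agree by uniqueness.
  refine ⟨fun ξ => if ξ ≤ 0 then 0 else Φ ξ ξ, fun ξ hξ => if_pos hξ, fun L hL => ?_⟩
  refine (hΦ L hL).congr fun s hs => ?_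
  rw [if_neg hs.1.not_ge]
  exact (hΦ s hs.1).unique hγ ((hΦ L hL).mono hs.2) ⟨hs.1, le_rfl⟩

/-! ### Half profiles -/

/-- The restriction of `ψ` to `[0, ∞)` is the part of an admissible profile to the right of its
free boundary, located at `0`. -/
structure IsHalfProfile (γ c : ℝ) (ψ : ℝ → ℝ) : Prop where
  zero : ψ 0 = 0
  continuousOn : ContinuousOn ψ (Ici 0)
  pos : ∀ ξ > 0, 0 < ψ ξ
  contDiffOn : ContDiffOn ℝ 2 ψ (Ioi 0)
  equation : ∀ ξ > 0, c * deriv ψ ξ + deriv (deriv ψ) ξ = γ * ψ ξ ^ (γ - 1)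
  freeBoundary : Tendsto (fun ξ => |deriv (fun y => ψ y ^ (1 / betaExp γ)) ξ|) (𝓝[>] 0)
    (𝓝 (√2 / betaExp γ))

theorem hasDerivAt_rpow_inv {x p : ℝ} (hφ : HasDerivAt φ p x) (hx : 0 < φ x) :
    HasDerivAt (fun y => φ y ^ (1 / betaExp γ))
      (1 / betaExp γ * φ x ^ (1 / betaExp γ - 1) * p) x := by
  refine (hφ.rpow_const (Or.inl hx.ne')).congr_deriv ?_
  ring

/-! ### Mild solutions are half profiles -/

section Mild

theorem tendsto_one_of_exp_bounds {k : ℝ} {f g : ℝ → ℝ} (hg : ∀ t > 0, 0 < g t)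
    (h₁ : ∀ t > 0, f t ≤ Real.exp (k * t) * g t) (h₂ : ∀ t > 0, g t ≤ Real.exp (k * t) * f t) :
    Tendsto (fun t => f t / g t) (𝓝[>] 0) (𝓝 1) := by
  have e1 : Tendsto (fun t => Real.exp (k * t)) (𝓝[>] 0) (𝓝 1) := by
    have : Continuous fun t => Real.exp (k * t) := by fun_prop
    simpa using (this.tendsto 0).mono_left nhdsWithin_le_nhds
  have e2 : Tendsto (fun t => Real.exp (-k * t)) (𝓝[>] 0) (𝓝 1) := by
    have : Continuous fun t => Real.exp (-k * t) := by fun_prop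
    simpa using (this.tendsto 0).mono_left nhdsWithin_le_nhds
  refine tendsto_of_tendsto_of_tendsto_of_le_of_le' e2 e1 ?_ ?_
  · filter_upwards [self_mem_nhdsWithin] with t ht
    rw [le_div_iff₀ (hg t ht), neg_mul, Real.exp_neg, inv_mul_le_iff₀ (Real.exp_pos _)]
    exact h₂ t ht
  · filter_upwards [self_mem_nhdsWithin] with t ht
    rw [div_le_iff₀ (hg t ht)]
    exact h₁ t ht

variable (hγ : γ ∈ Ioc (0 : ℝ) 1) (h : ∀ L > 0, IsMild γ c L φ)
include hγ h

theorem hasDerivAt_of_isMild {t : ℝ} (ht : 0 < t) : HasDerivAt φ (flux γ c φ t) t := by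
  have hm := h (t + 1) (by linarith)
  have hd := hm.toModelLike.hasDerivAt_duhamel (c := c) hγ (t := t) ⟨ht, by linarith⟩
  refine hd.congr_of_eventuallyEq ?_
  filter_upwards [Ioo_mem_nhds ht (by linarith : t < t + 1)] with s hs
  exact hm.eq_duhamel s (Ioo_subset_Ioc_self hs)

theorem deriv_eq_flux {t : ℝ} (ht : 0 < t) : deriv φ t = flux γ c φ t :=
  (hasDerivAt_of_isMild hγ h ht).deriv

theorem hasDerivAt_deriv_of_isMild {t : ℝ} (ht : 0 < t) :
    HasDerivAt (deriv φ) (γ * φ t ^ (γ - 1) - c * deriv φ t) t := by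
  have hm := h (t + 1) (by linarith)
  have hd := hm.toModelLike.hasDerivAt_flux (c := c) hγ (t := t) ⟨ht, by linarith⟩
  rw [← deriv_eq_flux hγ h ht] at hd
  refine hd.congr_of_eventuallyEq ?_
  filter_upwards [Ioi_mem_nhds ht] with s hs
  exact deriv_eq_flux hγ h hs

/-- The comparison with the model is applied on `(0, t]` itself, so its constant `e^{|c|t/γ}` tends
to `1`. -/
theorem tendsto_div_model : Tendsto (fun t => φ t / model γ t) (𝓝[>] 0) (𝓝 1) := by
  refine tendsto_one_of_exp_bounds (k := |c| / γ) (fun t ht => model_pos hγ ht)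
    (fun t ht => ?_) fun t ht => ?_
  · have := (h t ht).le_exp_mul hγ (isMild_model hγ t) ⟨ht, le_rfl⟩
    rwa [sub_zero, mul_div_right_comm] at this
  · have := (isMild_model hγ t).le_exp_mul hγ (h t ht) ⟨ht, le_rfl⟩
    rwa [zero_sub, abs_neg, mul_div_right_comm] at this

theorem tendsto_deriv_div : Tendsto (fun t => deriv φ t /
    (cBeta γ * betaExp γ * t ^ (betaExp γ - 1))) (𝓝[>] 0) (𝓝 1) := by
  have hc := cBeta_pos hγ
  have hb := betaExp_pos hγ
  refine tendsto_one_of_exp_bounds (k := |c| / γ) (fun t ht => by positivity)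
    (fun t ht => ?_) fun t ht => ?_
  · have := (h t ht).flux_le_exp_mul hγ (isMild_model hγ t) (t := t) ⟨ht.le, le_rfl⟩
    rwa [sub_zero, mul_div_right_comm, flux_model hγ ht.le, ← deriv_eq_flux hγ h ht] at this
  · have := (isMild_model hγ t).flux_le_exp_mul hγ (h t ht) (t := t) ⟨ht.le, le_rfl⟩
    rwa [zero_sub, abs_neg, mul_div_right_comm, flux_model hγ ht.le,
      ← deriv_eq_flux hγ h ht] at this

/-- In `(1/β) φ^{1/β-1} φ'` both factors may be replaced by those of the model, for which the powers
of `t` cancel and `c_β^{1/β} = √2/β` remains. -/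
theorem tendsto_deriv_rpow_inv : Tendsto (deriv fun y => φ y ^ (1 / betaExp γ)) (𝓝[>] 0)
    (𝓝 (√2 / betaExp γ)) := by
  have hc := cBeta_pos hγ
  have hb := betaExp_pos hγ
  have h1 := ((tendsto_div_model hγ h).rpow_const (p := 1 / betaExp γ - 1)
    (Or.inl one_ne_zero)).mul (tendsto_deriv_div hγ h)
  rw [Real.one_rpow, one_mul] at h1
  have h2 := h1.mul_const (√2 / betaExp γ)
  rw [one_mul] at h2
  refine h2.congr' ?_
  filter_upwards [self_mem_nhdsWithin] with t (ht : 0 < t)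
  have hφ := (h t ht).toModelLike.pos hγ ⟨ht, le_rfl⟩
  have hq := model_pos hγ ht
  rw [(hasDerivAt_rpow_inv (hasDerivAt_of_isMild hγ h ht) hφ).deriv, ← deriv_eq_flux hγ h ht,
    Real.div_rpow hφ.le hq.le, ← cBeta_rpow_inv hγ]
  have e1 : model γ t ^ (1 / betaExp γ - 1) * (cBeta γ * t ^ (betaExp γ - 1)) =
      cBeta γ ^ (1 / betaExp γ) := by
    rw [model, Real.mul_rpow hc.le (by positivity), ← Real.rpow_mul ht.le,
      mul_mul_mul_comm, ← Real.rpow_add ht, ← Real.rpow_add_one hc.ne',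
      show betaExp γ * (1 / betaExp γ - 1) + (betaExp γ - 1) = 0 by field_simp; ring,
      Real.rpow_zero, mul_one, sub_add_cancel]
  rw [← e1]
  have : model γ t ^ (1 / betaExp γ - 1) ≠ 0 := (Real.rpow_pos_of_pos hq _).ne'
  have : t ^ (betaExp γ - 1) ≠ 0 := (Real.rpow_pos_of_pos ht _).ne'
  field_simp

theorem isHalfProfile_of_isMild (h0 : φ 0 = 0) : IsHalfProfile γ c φ := by
  have hc : ContinuousOn φ (Ioi 0) := fun t ht =>
    (hasDerivAt_of_isMild hγ h ht).continuousAt.continuousWithinAt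
  have hp : ∀ ξ > 0, 0 < φ ξ := fun ξ hξ => (h ξ hξ).toModelLike.pos hγ ⟨hξ, le_rfl⟩
  refine ⟨h0, ?_, hp, ?_, ?_, ?_⟩
  · intro x hx
    rcases (mem_Ici.1 hx).eq_or_lt with rfl | hx
    · have hm := h 1 one_pos
      have := (hm.toModelLike.continuousOn_duhamel (c := c) hγ zero_le_one) 0 (by simp)
      have h2 : ContinuousWithinAt φ (Icc 0 1) 0 := by
        refine this.congr (fun s hs => ?_) (by simp [h0, duhamel])
        rcases hs.1.eq_or_lt with rfl | hs0
        · simp [h0, duhamel]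
        · exact hm.eq_duhamel s ⟨hs0, hs.2⟩
      refine h2.mono_of_mem_nhdsWithin ?_
      exact Icc_mem_nhdsGE one_pos
    · exact (hasDerivAt_of_isMild hγ h hx).continuousAt.continuousWithinAt
  · rw [show (2 : WithTop ℕ∞) = 1 + 1 by norm_num,
      contDiffOn_succ_iff_deriv_of_isOpen isOpen_Ioi]
    refine ⟨fun t ht => (hasDerivAt_of_isMild hγ h ht).differentiableAt.differentiableWithinAt,
      by simp, ?_⟩
    rw [show (1 : WithTop ℕ∞) = 0 + 1 by norm_num,
      contDiffOn_succ_iff_deriv_of_isOpen isOpen_Ioi]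
    have hd : ∀ t ∈ Ioi (0 : ℝ), HasDerivAt (deriv φ) (γ * φ t ^ (γ - 1) - c * deriv φ t) t :=
      fun t ht => hasDerivAt_deriv_of_isMild hγ h ht
    refine ⟨fun t ht => (hd t ht).differentiableAt.differentiableWithinAt, by simp, ?_⟩
    rw [contDiffOn_zero]
    refine ContinuousOn.congr ?_ fun t ht => (hd t ht).deriv
    refine ContinuousOn.sub ?_ (continuousOn_const.mul fun t ht =>
      (hd t ht).continuousAt.continuousWithinAt)
    exact continuousOn_const.mul (hc.rpow_const fun t ht => Or.inl (hp t ht).ne')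
  · intro ξ hξ
    rw [(hasDerivAt_deriv_of_isMild hγ h hξ).deriv]; ring
  · have := (tendsto_deriv_rpow_inv hγ h).abs
    rwa [abs_of_pos (div_pos (by positivity) (betaExp_pos hγ))] at this

end Mild

/-! ### Half profiles are mild solutions -/

namespace IsHalfProfile

theorem hasDerivAt (h : IsHalfProfile γ c ψ) {ξ : ℝ} (hξ : 0 < ξ) :
    HasDerivAt ψ (deriv ψ ξ) ξ :=
  ((h.contDiffOn.differentiableOn (by norm_num)).differentiableAt (Ioi_mem_nhds hξ)).hasDerivAt

theorem hasDerivAt_deriv (h : IsHalfProfile γ c ψ) {ξ : ℝ} (hξ : 0 < ξ) :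
    HasDerivAt (deriv ψ) (γ * ψ ξ ^ (γ - 1) - c * deriv ψ ξ) ξ := by
  have h2 := h.contDiffOn
  rw [show (2 : WithTop ℕ∞) = 1 + 1 by norm_num,
      contDiffOn_succ_iff_deriv_of_isOpen isOpen_Ioi] at h2
  have := ((h2.2.2.differentiableOn (by norm_num)).differentiableAt (Ioi_mem_nhds hξ)).hasDerivAt
  refine this.congr_deriv ?_
  linarith [h.equation ξ hξ]

theorem hasDerivAt_exp_mul_deriv (h : IsHalfProfile γ c ψ) {ξ : ℝ} (hξ : 0 < ξ) :
    HasDerivAt (fun s => Real.exp (c * s) * deriv ψ s)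
      (γ * ψ ξ ^ (γ - 1) * Real.exp (c * ξ)) ξ := by
  have h1 : HasDerivAt (fun s => Real.exp (c * s)) (Real.exp (c * ξ) * c) ξ := by
    simpa using ((hasDerivAt_id ξ).const_mul c).exp
  refine (h1.mul (h.hasDerivAt_deriv hξ)).congr_deriv ?_
  ring

theorem source_pos (hγ : γ ∈ Ioc (0 : ℝ) 1) (h : IsHalfProfile γ c ψ) {ξ : ℝ} (hξ : 0 < ξ) :
    0 < γ * ψ ξ ^ (γ - 1) :=
  mul_pos hγ.1 (Real.rpow_pos_of_pos (h.pos ξ hξ) _)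

/-- The function `e^{cs} ψ'` is strictly increasing. If it were nonpositive at `ξ`, then `ψ` would
decrease on `[0, ξ]` from the value `0`, against positivity. -/
theorem deriv_pos (hγ : γ ∈ Ioc (0 : ℝ) 1) (h : IsHalfProfile γ c ψ) {ξ : ℝ} (hξ : 0 < ξ) :
    0 < deriv ψ ξ := by
  by_contra! hneg
  have hmono : StrictMonoOn (fun s => Real.exp (c * s) * deriv ψ s) (Ioi 0) := by
    refine strictMonoOn_of_deriv_pos (convex_Ioi 0)
      (fun s hs => (h.hasDerivAt_exp_mul_deriv hs).continuousAt.continuousWithinAt) fun s hs => ?_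
    rw [interior_Ioi] at hs
    rw [(h.hasDerivAt_exp_mul_deriv hs).deriv]
    exact mul_pos (h.source_pos hγ hs) (Real.exp_pos _)
  have hanti : StrictAntiOn ψ (Icc 0 ξ) := by
    refine strictAntiOn_of_deriv_neg (convex_Icc 0 ξ)
      (h.continuousOn.mono Icc_subset_Ici_self) fun s hs => ?_
    rw [interior_Icc] at hs
    have h1 := hmono hs.1 hξ hs.2
    have h2 : Real.exp (c * ξ) * deriv ψ ξ ≤ 0 :=
      mul_nonpos_of_nonneg_of_nonpos (Real.exp_pos _).le hneg
    exact neg_of_mul_neg_right (h1.trans_le h2) (Real.exp_pos _).le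
  have := hanti ⟨le_rfl, hξ.le⟩ ⟨hξ.le, le_rfl⟩ hξ
  rw [h.zero] at this
  exact this.not_gt (h.pos ξ hξ)

theorem tendsto_deriv_rpow (hγ : γ ∈ Ioc (0 : ℝ) 1) (h : IsHalfProfile γ c ψ) :
    Tendsto (deriv fun y => ψ y ^ (1 / betaExp γ)) (𝓝[>] 0) (𝓝 (√2 / betaExp γ)) := by
  have hb := betaExp_pos hγ
  refine h.freeBoundary.congr' ?_
  filter_upwards [self_mem_nhdsWithin] with t (ht : 0 < t)
  rw [(hasDerivAt_rpow_inv (h.hasDerivAt ht) (h.pos t ht)).deriv, abs_of_pos]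
  have := h.pos t ht
  have := h.deriv_pos hγ ht
  positivity

theorem tendsto_zero (h : IsHalfProfile γ c ψ) : Tendsto ψ (𝓝[>] 0) (𝓝 0) := by
  have := h.continuousOn 0 self_mem_Ici
  rw [ContinuousWithinAt, h.zero] at this
  exact this.mono_left (nhdsWithin_mono _ Ioi_subset_Ici_self)

/-- The limit of `(ψ^{1/β})'` is the one-sided derivative of `ψ^{1/β}` at `0`; the power `β` of its
difference quotient is `ψ(t) / t^β`. -/
theorem tendsto_div_model (hγ : γ ∈ Ioc (0 : ℝ) 1) (h : IsHalfProfile γ c ψ) :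
    Tendsto (fun t => ψ t / model γ t) (𝓝[>] 0) (𝓝 1) := by
  have hb := betaExp_pos hγ
  have hc := cBeta_pos hγ
  set u := fun y => ψ y ^ (1 / betaExp γ) with hu
  have hcont : ContinuousOn u (Ici 0) :=
    h.continuousOn.rpow_const fun s _ => Or.inr (by positivity)
  have hd : HasDerivWithinAt u (√2 / betaExp γ) (Ici 0) 0 := by
    refine hasDerivWithinAt_Ici_of_tendsto_deriv (s := Ioi 0) (fun t ht => ?_)
      ((hcont 0 self_mem_Ici).mono Ioi_subset_Ici_self) self_mem_nhdsWithin
      (h.tendsto_deriv_rpow hγ)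
    exact (hasDerivAt_rpow_inv (h.hasDerivAt ht)
      (h.pos t ht)).differentiableAt.differentiableWithinAt
  rw [hasDerivWithinAt_iff_tendsto_slope, Ici_sdiff_left, ← cBeta_rpow_inv hγ] at hd
  have h1 := (hd.rpow_const (p := betaExp γ) (Or.inr hb.le)).div_const (cBeta γ)
  rw [← Real.rpow_mul hc.le, one_div_mul_cancel hb.ne', Real.rpow_one, div_self hc.ne'] at h1
  refine h1.congr' ?_
  filter_upwards [self_mem_nhdsWithin] with t (ht : 0 < t)
  have hp := h.pos t ht
  have h0 : u 0 = 0 := by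
    simp only [hu, h.zero]
    exact Real.zero_rpow (by positivity)
  rw [slope_def_field, h0, sub_zero, sub_zero, hu, Real.div_rpow (by positivity) ht.le,
    ← Real.rpow_mul hp.le, one_div_mul_cancel hb.ne', Real.rpow_one, model, div_div,
    mul_comm (cBeta γ)]

/-- One has `ψ' = β ψ^{1-1/β} (ψ^{1/β})'`, where the exponent `1 - 1/β` is positive and the last
factor converges. -/
theorem tendsto_deriv_zero (hγ : γ ∈ Ioc (0 : ℝ) 1) (h : IsHalfProfile γ c ψ) :
    Tendsto (deriv ψ) (𝓝[>] 0) (𝓝 0) := by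
  have hb := one_lt_betaExp hγ
  have hb0 := betaExp_pos hγ
  have he : 0 < 1 - 1 / betaExp γ := by rw [sub_pos, div_lt_one hb0]; exact hb
  have h1 := ((h.tendsto_zero.rpow_const (p := 1 - 1 / betaExp γ) (Or.inr he.le)).mul
    (h.tendsto_deriv_rpow hγ)).const_mul (betaExp γ)
  rw [Real.zero_rpow he.ne', zero_mul, mul_zero] at h1
  refine h1.congr' ?_
  filter_upwards [self_mem_nhdsWithin] with t (ht : 0 < t)
  have hp := h.pos t ht
  rw [(hasDerivAt_rpow_inv (h.hasDerivAt ht) hp).deriv]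
  have : ψ t ^ (1 - 1 / betaExp γ) * ψ t ^ (1 / betaExp γ - 1) = 1 := by
    rw [← Real.rpow_add hp]; simp
  calc betaExp γ * (ψ t ^ (1 - 1 / betaExp γ) *
        (1 / betaExp γ * ψ t ^ (1 / betaExp γ - 1) * deriv ψ t))
      = betaExp γ * (1 / betaExp γ) *
        (ψ t ^ (1 - 1 / betaExp γ) * ψ t ^ (1 / betaExp γ - 1)) * deriv ψ t := by ring
    _ = deriv ψ t := by rw [this, mul_one_div_cancel hb0.ne', one_mul, one_mul]

theorem modelLike (hγ : γ ∈ Ioc (0 : ℝ) 1) (h : IsHalfProfile γ c ψ) (L : ℝ) :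
    ModelLike γ L ψ := by
  have hcont : ContinuousOn ψ (Ioi 0) := h.continuousOn.mono Ioi_subset_Ici_self
  refine ⟨hcont.mono Ioc_subset_Ioi_self, ?_⟩
  set r := fun t => Real.log (ψ t / model γ t)
  -- The ratio tends to `1`, so its logarithm extends by `0` to a continuous function on a compact
  -- interval.
  have hrc : ContinuousOn (Function.update r 0 0) (Icc 0 L) := by
    rw [continuousOn_update_iff]
    have hsub : Icc 0 L \ {0} ⊆ Ioi (0 : ℝ) := fun s hs => hs.1.1.lt_of_ne' hs.2
    refine ⟨ContinuousOn.mono ?_ hsub, fun _ => ?_⟩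
    · refine ContinuousOn.log (hcont.div (continuous_model hγ).continuousOn
        fun t ht => (model_pos hγ ht).ne') fun t ht => ?_
      exact (div_pos (h.pos t ht) (model_pos hγ ht)).ne'
    · have := (h.tendsto_div_model hγ).log one_ne_zero
      rw [Real.log_one] at this
      exact this.mono_left (nhdsWithin_mono _ hsub)
  obtain ⟨m, hm⟩ := isCompact_Icc.exists_bound_of_continuousOn hrc
  refine ⟨m, fun s hs => ?_⟩
  have h1 := hm s (Ioc_subset_Icc_self hs)
  have hp := h.pos s hs.1
  have hq := model_pos hγ hs.1
  rw [Function.update_of_ne hs.1.ne', Real.norm_eq_abs,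
    show r s = _ from Real.log_div hp.ne' hq.ne', abs_le] at h1
  constructor
  · rw [← Real.log_le_log_iff hq (by positivity), Real.log_mul (Real.exp_pos m).ne' hp.ne',
      Real.log_exp]
    linarith [h1.1]
  · rw [← Real.log_le_log_iff hp (by positivity), Real.log_mul (Real.exp_pos m).ne' hq.ne',
      Real.log_exp]
    linarith [h1.2]

/-- Integrating `(e^{cs} ψ')'` from `0` leaves no boundary term there because `ψ' → 0`. -/
theorem flux_eq_deriv (hγ : γ ∈ Ioc (0 : ℝ) 1) (h : IsHalfProfile γ c ψ) {t : ℝ} (ht : 0 < t) :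
    flux γ c ψ t = deriv ψ t := by
  have hlim : Tendsto (fun s => Real.exp (c * s) * deriv ψ s) (𝓝[>] 0) (𝓝 0) := by
    have : Continuous fun s => Real.exp (c * s) := by fun_prop
    simpa using ((this.tendsto 0).mono_left nhdsWithin_le_nhds).mul (h.tendsto_deriv_zero hγ)
  have hend := ((h.hasDerivAt_exp_mul_deriv ht).continuousAt.tendsto).mono_left
    (nhdsWithin_le_nhds (s := Iio t))
  rw [flux_eq, intervalIntegral.integral_eq_sub_of_hasDerivAt_of_tendsto ht
    (fun s hs => h.hasDerivAt_exp_mul_deriv hs.1)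
    ((h.modelLike hγ t).intervalIntegrable_source hγ ht.le (by fun_prop)) hlim hend, sub_zero,
    ← mul_assoc, ← Real.exp_add]
  simp

theorem isMild (hγ : γ ∈ Ioc (0 : ℝ) 1) (h : IsHalfProfile γ c ψ) (L : ℝ) : IsMild γ c L ψ := by
  refine ⟨h.modelLike hγ L, fun ξ hξ => ?_⟩
  rw [duhamel, intervalIntegral.integral_eq_sub_of_hasDerivAt_of_le hξ.1.le
    (h.continuousOn.mono Icc_subset_Ici_self)
    (fun s hs => by rw [h.flux_eq_deriv hγ hs.1]; exact h.hasDerivAt hs.1)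
    ((h.modelLike hγ ξ).intervalIntegrable_flux hγ hξ.1.le), h.zero, sub_zero]

theorem unique (hγ : γ ∈ Ioc (0 : ℝ) 1) (h₁ : IsHalfProfile γ c φ) (h₂ : IsHalfProfile γ c ψ)
    {ξ : ℝ} (hξ : 0 ≤ ξ) : φ ξ = ψ ξ := by
  rcases hξ.eq_or_lt with rfl | hξ
  · rw [h₁.zero, h₂.zero]
  · exact (h₁.isMild hγ ξ).unique hγ (h₂.isMild hγ ξ) ⟨hξ, le_rfl⟩

end IsHalfProfile

/-! ### Behaviour at infinity -/

theorem le_of_hasDerivAt_le {f f' g g' : ℝ → ℝ} {a : ℝ} (hf : ∀ x ≥ a, HasDerivAt f (f' x) x)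
    (hg : ∀ x ≥ a, HasDerivAt g (g' x) x) (hle : ∀ x ≥ a, f' x ≤ g' x) {x : ℝ} (hx : a ≤ x) :
    f x - f a ≤ g x - g a := by
  have : MonotoneOn (fun x => g x - f x) (Ici a) := by
    refine monotoneOn_of_deriv_nonneg (convex_Ici a)
      (fun x hx => ((hg x hx).sub (hf x hx)).continuousAt.continuousWithinAt)
      (fun x hx => ?_) fun x hx => ?_
    · rw [interior_Ici] at hx
      exact ((hg x (le_of_lt hx)).sub (hf x (le_of_lt hx))).differentiableAt.differentiableWithinAt
    · rw [interior_Ici] at hx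
      have := ((hg x (le_of_lt hx)).sub (hf x (le_of_lt hx))).deriv
      have h2 := hle x (le_of_lt hx)
      change 0 ≤ deriv (g - f) x
      rw [this]; linarith
  have := this self_mem_Ici hx hx
  simp only at this
  linarith

/-- One half of L'Hôpital's rule for quotients with denominator tending to infinity. -/
theorem eventually_div_lt_of_hasDerivAt {f f' g g' : ℝ → ℝ} {k l a : ℝ}
    (hf : ∀ x > a, HasDerivAt f (f' x) x) (hg : ∀ x > a, HasDerivAt g (g' x) x)
    (hg' : ∀ x > a, 0 < g' x) (htop : Tendsto g atTop atTop)
    (h : Tendsto (fun x => f' x / g' x) atTop (𝓝 l)) (hk : l < k) :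
    ∀ᶠ x in atTop, f x / g x < k := by
  -- The gap between `k'` and `k` absorbs the constant of integration once `g` is large.
  obtain ⟨k', hk', hk'k⟩ := exists_between hk
  obtain ⟨b, hb⟩ := eventually_atTop.1 ((h.eventually_lt_const hk').and (eventually_gt_atTop a))
  have key : ∀ x ≥ b, f x - f b ≤ k' * g x - k' * g b := fun x hx =>
    le_of_hasDerivAt_le (fun y hy => hf y (hb y hy).2) (fun y hy => (hg y (hb y hy).2).const_mul k')
      (fun y hy => ((div_lt_iff₀ (hg' y (hb y hy).2)).1 (hb y hy).1).le) hx
  have h2 : Tendsto (fun x => (k - k') * g x) atTop atTop :=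
    htop.const_mul_atTop (by linarith)
  filter_upwards [h2.eventually_gt_atTop (f b - k' * g b), htop.eventually_gt_atTop 0,
    eventually_ge_atTop b] with x h1 h2 h3
  rw [div_lt_iff₀ h2]
  linarith [key x h3]

/-- L'Hôpital's rule for quotients with denominator tending to infinity. -/
theorem tendsto_div_of_hasDerivAt {f f' g g' : ℝ → ℝ} {l a : ℝ}
    (hf : ∀ x > a, HasDerivAt f (f' x) x) (hg : ∀ x > a, HasDerivAt g (g' x) x)
    (hg' : ∀ x > a, 0 < g' x) (htop : Tendsto g atTop atTop)
    (h : Tendsto (fun x => f' x / g' x) atTop (𝓝 l)) :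
    Tendsto (fun x => f x / g x) atTop (𝓝 l) := by
  rw [tendsto_order]
  refine ⟨fun k hk => ?_, fun k hk => eventually_div_lt_of_hasDerivAt hf hg hg' htop h hk⟩
  have := eventually_div_lt_of_hasDerivAt (f := fun x => -f x) (f' := fun x => -f' x) (l := -l)
    (k := -k) (fun x hx => (hf x hx).neg) hg hg' htop (by simpa only [neg_div] using h.neg)
    (by linarith)
  filter_upwards [this] with x hx
  rw [neg_div] at hx
  linarith

theorem tendsto_div_id {f f' : ℝ → ℝ} {l : ℝ} (hf : ∀ x > 0, HasDerivAt f (f' x) x)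
    (h : Tendsto f' atTop (𝓝 l)) : Tendsto (fun x => f x / x) atTop (𝓝 l) :=
  tendsto_div_of_hasDerivAt (g' := fun _ => 1) hf (fun x _ => hasDerivAt_id x)
    (fun _ _ => one_pos) tendsto_id (by simpa using h)

/-- Solutions of `f' = g - c f` with `c > 0` and convergent `g` converge. -/
theorem tendsto_of_hasDerivAt_sub {f g : ℝ → ℝ} {l : ℝ} (hc : 0 < c)
    (hf : ∀ x > 0, HasDerivAt f (g x - c * f x) x) (hg : Tendsto g atTop (𝓝 l)) :
    Tendsto f atTop (𝓝 (l / c)) := by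
  have he : ∀ x, HasDerivAt (fun x => Real.exp (c * x)) (Real.exp (c * x) * c) x := fun x => by
    simpa using ((hasDerivAt_id x).const_mul c).exp
  have h1 : Tendsto (fun x => (f x * Real.exp (c * x)) / Real.exp (c * x)) atTop (𝓝 (l / c)) := by
    refine tendsto_div_of_hasDerivAt (a := 0) (f' := fun x => g x * Real.exp (c * x))
      (fun x hx => ((hf x hx).mul (he x)).congr_deriv (by ring)) (fun x _ => he x)
      (fun x _ => by positivity)
      (Real.tendsto_exp_atTop.comp (tendsto_id.const_mul_atTop hc)) ?_
    refine (hg.div_const c).congr fun x => ?_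
    have := (Real.exp_pos (c * x)).ne'
    field_simp
  refine h1.congr fun x => ?_
  have := (Real.exp_pos (c * x)).ne'
  field_simp

namespace IsHalfProfile

variable (hγ : γ ∈ Ioc (0 : ℝ) 1) (h : IsHalfProfile γ c ψ)
include hγ h

theorem monotoneOn : MonotoneOn ψ (Ici 0) :=
  monotoneOn_of_deriv_nonneg (convex_Ici 0) h.continuousOn
    (fun x hx => by
      rw [interior_Ici] at hx ⊢
      exact (h.hasDerivAt hx).differentiableAt.differentiableWithinAt)
    fun x hx => by
      rw [interior_Ici] at hx
      exact (h.deriv_pos hγ hx).le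

/-- Were `ψ` to converge to `B`, then `(ψ' + cψ)' → γ B^{γ-1} > 0` would make `ψ' + cψ`, and hence
`ψ'`, tend to infinity. -/
theorem tendsto_atTop : Tendsto ψ atTop atTop := by
  have hmono : Monotone fun x => ψ (max x 0) := fun x y hxy =>
    h.monotoneOn hγ (mem_Ici.2 (le_max_right x 0)) (mem_Ici.2 (le_max_right y 0))
      (max_le_max_right 0 hxy)
  have heq : (fun x => ψ (max x 0)) =ᶠ[atTop] ψ := by
    filter_upwards [eventually_ge_atTop 0] with x hx
    rw [max_eq_left hx]
  rcases tendsto_atTop_of_monotone hmono with ht | ⟨B, hB⟩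
  · exact ht.congr' heq
  replace hB : Tendsto ψ atTop (𝓝 B) := hB.congr' heq
  have hBpos : 0 < B := by
    refine (h.pos 1 one_pos).trans_le (ge_of_tendsto hB ?_)
    filter_upwards [eventually_ge_atTop 1] with x hx
    exact h.monotoneOn hγ (by simp) (by simp; linarith) hx
  have hsrc : Tendsto (fun x => γ * ψ x ^ (γ - 1)) atTop (𝓝 (γ * B ^ (γ - 1))) :=
    (hB.rpow_const (Or.inl hBpos.ne')).const_mul γ
  have hl : 0 < γ * B ^ (γ - 1) := mul_pos hγ.1 (Real.rpow_pos_of_pos hBpos _)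
  have hz : Tendsto (fun x => (deriv ψ x + c * ψ x) / x) atTop (𝓝 (γ * B ^ (γ - 1))) :=
    tendsto_div_id (fun x hx => ((h.hasDerivAt_deriv hx).add
      ((h.hasDerivAt hx).const_mul c)).congr_deriv (by ring)) hsrc
  have hz' : Tendsto (fun x => deriv ψ x + c * ψ x) atTop atTop := by
    refine (hz.pos_mul_atTop hl tendsto_id).congr' ?_
    filter_upwards [eventually_gt_atTop 0] with x hx
    simp only [id]
    field_simp
  have hd : Tendsto (deriv ψ) atTop atTop := by
    have := hz'.atTop_add ((hB.const_mul c).neg)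
    refine this.congr fun x => by ring
  exfalso
  obtain ⟨a, ha⟩ := eventually_atTop.1 ((hd.eventually_ge_atTop 1).and (eventually_gt_atTop 0))
  have hle : ∀ x ≥ a, x - a ≤ ψ x - ψ a := fun x hx =>
    le_of_hasDerivAt_le (f := fun x => x) (f' := fun _ => 1) (fun y _ => hasDerivAt_id y)
      (fun y hy => h.hasDerivAt (ha y hy).2) (fun y hy => (ha y hy).1) hx
  have hBx : ∀ᶠ x in atTop, ψ x < B + 1 := hB.eventually_lt_const (by linarith)
  obtain ⟨x, hx1, hx2, hx3⟩ := (hBx.and ((eventually_ge_atTop a).and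
    (eventually_ge_atTop (B + 1 + a - ψ a)))).exists
  linarith [hle x hx2]

theorem isEquivalent_exp (hc : c < 0) :
    ∃ A > 0, ψ ~[atTop] fun ξ => A * Real.exp (-c * ξ) := by
  have he : ∀ k x : ℝ, HasDerivAt (fun x => Real.exp (k * x)) (Real.exp (k * x) * k) x :=
    fun k x => by simpa using ((hasDerivAt_id x).const_mul k).exp
  have hpos1 := h.pos 1 one_pos
  set K := γ * ψ 1 ^ (γ - 1)
  have hK : ∀ x ≥ 1, γ * ψ x ^ (γ - 1) ≤ K := fun x hx => by
    have h1 := h.monotoneOn hγ (by simp) (by simp; linarith) hx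
    exact mul_le_mul_of_nonneg_left
      (Real.rpow_le_rpow_of_nonpos hpos1 h1 (by linarith [hγ.2])) hγ.1.le
  have hK0 : 0 < K := h.source_pos hγ one_pos
  -- Here `(e^{cs} ψ')' ≤ K e^{cs}` is integrated from `1`; the right side is integrable at infinity
  -- as `c < 0`.
  obtain ⟨Y, hY⟩ : ∃ Y, ∀ x ≥ 1, deriv ψ x ≤ Y * Real.exp (-c * x) := by
    refine ⟨Real.exp (c * 1) * deriv ψ 1 - K / c * Real.exp (c * 1), fun x hx => ?_⟩
    have h1 := le_of_hasDerivAt_le (fun y hy => h.hasDerivAt_exp_mul_deriv (zero_lt_one.trans_le hy))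
      (fun y _ => ((he c y).const_mul (K / c)).congr_deriv
        (show _ = K * Real.exp (c * y) by field_simp [hc.ne]))
      (fun y hy => mul_le_mul_of_nonneg_right (hK y hy) (Real.exp_pos _).le) hx
    have h2 : K / c * Real.exp (c * x) ≤ 0 :=
      mul_nonpos_of_nonpos_of_nonneg (div_nonpos_of_nonneg_of_nonpos hK0.le hc.le)
        (Real.exp_pos _).le
    rw [neg_mul, Real.exp_neg, ← div_eq_mul_inv, le_div_iff₀ (Real.exp_pos _)]
    linarith
  obtain ⟨Z, hZ⟩ : ∃ Z, ∀ x ≥ 1, ψ x * Real.exp (c * x) ≤ Z := by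
    refine ⟨|ψ 1 - Y / -c * Real.exp (-c * 1)| + Y / -c, fun x hx => ?_⟩
    have h1 := le_of_hasDerivAt_le (fun y hy => h.hasDerivAt (zero_lt_one.trans_le hy))
      (fun y _ => ((he (-c) y).const_mul (Y / -c)).congr_deriv
        (show _ = Y * Real.exp (-c * y) by field_simp [hc.ne])) hY hx
    have h2 : Real.exp (c * x) ≤ 1 := Real.exp_le_one_iff.2 (by nlinarith)
    have h3 : Real.exp (-c * x) * Real.exp (c * x) = 1 := by rw [← Real.exp_add]; simp
    have h4 : ψ x ≤ |ψ 1 - Y / -c * Real.exp (-c * 1)| + Y / -c * Real.exp (-c * x) := by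
      linarith [le_abs_self (ψ 1 - Y / -c * Real.exp (-c * 1))]
    calc ψ x * Real.exp (c * x)
        ≤ (|ψ 1 - Y / -c * Real.exp (-c * 1)| + Y / -c * Real.exp (-c * x)) * Real.exp (c * x) := by
          gcongr
      _ = |ψ 1 - Y / -c * Real.exp (-c * 1)| * Real.exp (c * x) +
          Y / -c * (Real.exp (-c * x) * Real.exp (c * x)) := by ring
      _ ≤ _ := by
          rw [h3]
          linarith [mul_le_of_le_one_right (abs_nonneg (ψ 1 - Y / -c * Real.exp (-c * 1))) h2]
  -- `ψ' + cψ` vanishes in the limit at `0` and has the positive source as derivative; its sign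
  -- makes `ψ e^{cx}` nondecreasing.
  have hz : ∀ x > 0, 0 ≤ deriv ψ x + c * ψ x := by
    intro x hx
    have hmono : MonotoneOn (fun x => deriv ψ x + c * ψ x) (Ioi 0) := by
      have hd : ∀ y ∈ Ioi (0 : ℝ), HasDerivAt (fun x => deriv ψ x + c * ψ x)
          (γ * ψ y ^ (γ - 1)) y := fun y hy =>
        ((h.hasDerivAt_deriv hy).add ((h.hasDerivAt hy).const_mul c)).congr_deriv (by ring)
      refine monotoneOn_of_deriv_nonneg (convex_Ioi 0)
        (fun y hy => (hd y hy).continuousAt.continuousWithinAt) ?_ ?_ <;> rw [interior_Ioi]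
      · exact fun y hy => (hd y hy).differentiableAt.differentiableWithinAt
      · exact fun y hy => by rw [(hd y hy).deriv]; exact (h.source_pos hγ hy).le
    have hlim := (h.tendsto_deriv_zero hγ).add (h.tendsto_zero.const_mul c)
    rw [mul_zero, add_zero] at hlim
    refine le_of_tendsto hlim ?_
    filter_upwards [Ioo_mem_nhdsGT hx] with y hy
    exact hmono hy.1 hx hy.2.le
  have hw : ∀ x > 0, HasDerivAt (fun x => ψ x * Real.exp (c * x))
      ((deriv ψ x + c * ψ x) * Real.exp (c * x)) x := fun x hx =>
    ((h.hasDerivAt hx).mul (he c x)).congr_deriv (by ring)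
  have hwm : MonotoneOn (fun x => ψ x * Real.exp (c * x)) (Ioi 0) := by
    refine monotoneOn_of_deriv_nonneg (convex_Ioi 0)
      (fun y hy => (hw y hy).continuousAt.continuousWithinAt) ?_ ?_ <;> rw [interior_Ioi]
    · exact fun y hy => (hw y hy).differentiableAt.differentiableWithinAt
    · exact fun y hy => by
        rw [(hw y hy).deriv]; exact mul_nonneg (hz y hy) (Real.exp_pos _).le
  have hmono : Monotone fun x => ψ (max x 1) * Real.exp (c * max x 1) := fun x y hxy =>
    hwm (zero_lt_one.trans_le (le_max_right x 1)) (zero_lt_one.trans_le (le_max_right y 1))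
      (max_le_max_right 1 hxy)
  have hbdd : BddAbove (range fun x => ψ (max x 1) * Real.exp (c * max x 1)) := by
    refine ⟨Z, ?_⟩
    rintro _ ⟨x, rfl⟩
    exact hZ _ (le_max_right _ _)
  have hA := tendsto_atTop_ciSup hmono hbdd
  set A := ⨆ x, ψ (max x 1) * Real.exp (c * max x 1)
  have hA0 : 0 < A := by
    refine lt_of_lt_of_le ?_ (le_ciSup hbdd 1)
    rw [max_self]; positivity
  refine ⟨A, hA0, ?_⟩
  rw [isEquivalent_iff_tendsto_one (Eventually.of_forall fun x => by positivity)]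
  have h1 := hA.div_const A
  rw [div_self hA0.ne'] at h1
  refine h1.congr' ?_
  filter_upwards [eventually_ge_atTop 1] with x hx
  rw [max_eq_left hx, Pi.div_apply, neg_mul, Real.exp_neg]
  field_simp

/-- The source converges (to `1` if `γ = 1`, to `0` otherwise), hence so does `ψ'`, while `ψ^{-γ} →
0`. -/
theorem tendsto_deriv_sq_mul_rpow (hc : 0 < c) :
    Tendsto (fun x => deriv ψ x ^ 2 * ψ x ^ (-γ)) atTop (𝓝 0) := by
  obtain ⟨l, hl⟩ : ∃ l, Tendsto (fun x => γ * ψ x ^ (γ - 1)) atTop (𝓝 l) := by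
    rcases hγ.2.eq_or_lt with rfl | hlt
    · exact ⟨1, by simp⟩
    · refine ⟨γ * 0, Tendsto.const_mul γ ?_⟩
      have := (tendsto_rpow_neg_atTop (sub_pos.2 hlt)).comp (h.tendsto_atTop hγ)
      refine this.congr fun x => by simp
  have hd := tendsto_of_hasDerivAt_sub hc (fun x hx => h.hasDerivAt_deriv hx) hl
  simpa using (hd.pow 2).mul ((tendsto_rpow_neg_atTop hγ.1).comp (h.tendsto_atTop hγ))

/-- With `r = ψ^{1-γ} ψ'` one has `r' + c r = γ + (1-γ) ψ'² ψ^{-γ} → γ`, so `r → γ/c`. As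
`(ψ^{2-γ})' = (2-γ) r`, the power `ψ^{2-γ}` is asymptotically linear, and `β/2 = 1/(2-γ)`. -/
theorem isEquivalent_rpow (hc : 0 < c) :
    ψ ~[atTop] fun ξ => (2 * γ / (betaExp γ * c) * ξ) ^ (betaExp γ / 2) := by
  have hb := betaExp_pos hγ
  have hm := betaExp_mul_two_sub hγ
  have hγ0 := hγ.1
  set r := fun x => ψ x ^ (1 - γ) * deriv ψ x with hr
  have hrd : ∀ x > 0, HasDerivAt r
      ((γ + (1 - γ) * (deriv ψ x ^ 2 * ψ x ^ (-γ))) - c * r x) x := by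
    intro x hx
    have hp := h.pos x hx
    refine (((h.hasDerivAt hx).rpow_const (p := 1 - γ) (Or.inl hp.ne')).mul
      (h.hasDerivAt_deriv hx)).congr_deriv ?_
    have e1 : ψ x ^ (1 - γ) * ψ x ^ (γ - 1) = 1 := by rw [← Real.rpow_add hp]; simp
    rw [show 1 - γ - 1 = -γ by ring]
    linear_combination γ * e1
  have hrl : Tendsto r atTop (𝓝 (γ / c)) :=
    tendsto_of_hasDerivAt_sub hc hrd (by
      simpa using ((h.tendsto_deriv_sq_mul_rpow hγ hc).const_mul (1 - γ)).const_add γ)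
  have hv : Tendsto (fun x => ψ x ^ (2 - γ) / x) atTop (𝓝 ((2 - γ) * (γ / c))) := by
    refine tendsto_div_id (f' := fun x => (2 - γ) * r x) (fun x hx => ?_) (hrl.const_mul _)
    refine ((h.hasDerivAt hx).rpow_const (p := 2 - γ) (Or.inl (h.pos x hx).ne')).congr_deriv ?_
    rw [show 2 - γ - 1 = 1 - γ by ring, hr]; ring
  set k := 2 * γ / (betaExp γ * c)
  have hk : 0 < k := by positivity
  have hkeq : (2 - γ) * (γ / c) = k := by
    rw [show 2 - γ = 2 / betaExp γ by field_simp; linarith]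
    simp only [k]; field_simp
  rw [hkeq] at hv
  have h1 := (hv.div_const k).rpow_const (p := betaExp γ / 2) (Or.inr (by positivity))
  rw [div_self hk.ne', Real.one_rpow] at h1
  rw [isEquivalent_iff_tendsto_one]
  · refine h1.congr' ?_
    filter_upwards [eventually_gt_atTop 0] with x hx
    have hp := h.pos x hx
    rw [Pi.div_apply, div_div, Real.div_rpow (by positivity) (by positivity), ← Real.rpow_mul hp.le,
      show (2 - γ) * (betaExp γ / 2) = 1 by linarith, Real.rpow_one, mul_comm x]
  · filter_upwards [eventually_gt_atTop 0] with x hx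
    positivity

end IsHalfProfile

/-! ### Admissible profiles and half profiles -/

theorem IsHalfProfile.isAdmissible (h : IsHalfProfile γ c φ) (h0 : ∀ ξ ≤ 0, φ ξ = 0) :
    IsAdmissible γ c φ := by
  have hpos : posSet φ = Ioi 0 := by
    ext ξ
    refine ⟨fun hξ => ?_, h.pos ξ⟩
    by_contra hle
    exact hξ.ne' (h0 ξ (not_lt.1 hle))
  have hc : Continuous φ := by
    have h1 : ContinuousOn φ (Iic 0) := continuousOn_const.congr fun x hx => h0 x hx
    have := h1.union_of_isClosed h.continuousOn isClosed_Iic isClosed_Ici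
    rwa [Iic_union_Ici, continuousOn_univ] at this
  refine ⟨hc, fun ξ => ?_, ⟨1, h.pos 1 one_pos⟩, ⟨0, h.zero⟩, ?_, ?_, ?_⟩
  · rcases le_or_gt ξ 0 with hξ | hξ
    · exact (h0 ξ hξ).ge
    · exact (h.pos ξ hξ).le
  · rw [hpos]; exact h.contDiffOn
  · rw [hpos]; exact h.equation
  · rw [hpos, frontier_Ioi]
    rintro _ rfl
    exact h.freeBoundary

theorem IsHalfProfile.isRightward (hγ : γ ∈ Ioc (0 : ℝ) 1) (h : IsHalfProfile γ c φ)
    (h0 : ∀ ξ ≤ 0, φ ξ = 0) : IsRightward φ :=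
  ⟨h0, fun _ hξ => h.deriv_pos hγ hξ⟩

namespace IsAdmissible

theorem isOpen_posSet (h : IsAdmissible γ c ψ) : IsOpen (posSet ψ) :=
  isOpen_lt continuous_const h.continuous

theorem isHalfProfile (h : IsAdmissible γ c ψ) {p : ℝ} (hp : ψ p = 0)
    (hpos : ∀ ξ > p, 0 < ψ ξ) : IsHalfProfile γ c fun x => ψ (x + p) := by
  have hmaps : MapsTo (fun x => x + p) (Ioi 0) (posSet ψ) := fun x hx =>
    hpos _ (by linarith [mem_Ioi.1 hx])
  have hd : (deriv fun x => ψ (x + p)) = fun x => deriv ψ (x + p) :=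
    funext fun x => deriv_comp_add_const ψ p x
  refine ⟨by simpa using hp, (h.continuous.comp (by fun_prop)).continuousOn,
    fun ξ hξ => hmaps hξ, h.contDiffOn.comp (by fun_prop) hmaps, fun ξ hξ => ?_, ?_⟩
  · rw [hd, deriv_comp_add_const]
    exact h.equation _ (hmaps hξ)
  · have hfr : p ∈ frontier (posSet ψ) := by
      rw [h.isOpen_posSet.frontier_eq]
      refine ⟨closure_mono (fun x hx => hpos x hx : Ioi p ⊆ posSet ψ) (by simp), fun hm => ?_⟩
      exact (show 0 < ψ p from hm).ne' hp
    have ht : Tendsto (fun x => x + p) (𝓝[>] 0) (𝓝[posSet ψ] p) := by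
      refine tendsto_nhdsWithin_iff.2 ⟨?_, ?_⟩
      · have : Continuous fun x : ℝ => x + p := by fun_prop
        simpa using (this.tendsto 0).mono_left nhdsWithin_le_nhds
      · filter_upwards [self_mem_nhdsWithin] with x hx using hmaps hx
    refine ((h.freeBoundary p hfr).comp ht).congr fun x => ?_
    exact congrArg _ (deriv_comp_add_const (fun y => ψ y ^ (1 / betaExp γ)) p x).symm

theorem comp_neg (h : IsAdmissible γ c ψ) : IsAdmissible γ (-c) fun x => ψ (-x) := by
  have hset : (posSet fun x => ψ (-x)) = Neg.neg ⁻¹' posSet ψ := rfl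
  have hd : ∀ f : ℝ → ℝ, (deriv fun x => f (-x)) = fun x => -deriv f (-x) := fun f =>
    funext fun x => deriv_comp_neg f x
  refine ⟨h.continuous.comp continuous_neg, fun ξ => h.nonneg _, ?_, ?_, ?_, ?_, ?_⟩
  · obtain ⟨ξ, hξ⟩ := h.exists_pos
    exact ⟨-ξ, by simpa using hξ⟩
  · obtain ⟨ξ, hξ⟩ := h.exists_zero
    exact ⟨-ξ, by simpa using hξ⟩
  · exact h.contDiffOn.comp contDiff_neg.contDiffOn fun x hx => hx
  · intro ξ hξ
    have := h.equation (-ξ) hξ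
    rw [hd, deriv.fun_neg, deriv_comp_neg (deriv ψ)]
    linarith
  · intro ξ hξ
    rw [hset, ← Homeomorph.coe_neg, ← (Homeomorph.neg ℝ).preimage_frontier] at hξ
    have ht : Tendsto (fun x : ℝ => -x) (𝓝[posSet fun x => ψ (-x)] ξ) (𝓝[posSet ψ] (-ξ)) := by
      refine tendsto_nhdsWithin_iff.2 ⟨(continuous_neg.tendsto ξ).mono_left nhdsWithin_le_nhds, ?_⟩
      filter_upwards [self_mem_nhdsWithin] with x hx using hx
    refine ((h.freeBoundary (-ξ) hξ).comp ht).congr fun x => ?_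
    have := deriv_comp_neg (fun y => ψ y ^ (1 / betaExp γ)) x
    rw [this, abs_neg]
    rfl

theorem eq_of_isRightward (hγ : γ ∈ Ioc (0 : ℝ) 1) (h : IsAdmissible γ c ψ)
    (hr : IsRightward ψ) (hφ : IsHalfProfile γ c φ) (h0 : ∀ ξ ≤ 0, φ ξ = 0) : ψ = φ := by
  have hmono : StrictMonoOn ψ (Ici 0) :=
    strictMonoOn_of_deriv_pos (convex_Ici 0) h.continuous.continuousOn fun x hx => by
      rw [interior_Ici] at hx; exact hr.2 x hx
  have hz := hr.1 0 le_rfl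
  have hh := h.isHalfProfile hz fun ξ hξ => by
    have := hmono self_mem_Ici (mem_Ici.2 (le_of_lt hξ)) hξ
    rwa [hz] at this
  simp only [add_zero] at hh
  ext ξ
  rcases le_total ξ 0 with hξ | hξ
  · rw [hr.1 ξ hξ, h0 ξ hξ]
  · exact hh.unique hγ hφ hξ

/-- The zero set of an admissible profile is order connected: there is no interior maximum. -/
theorem eq_zero_of_mem_Icc (hγ : γ ∈ Ioc (0 : ℝ) 1) (h : IsAdmissible γ c ψ) {x y z : ℝ}
    (hx : ψ x = 0) (hy : ψ y = 0) (hz : z ∈ Icc x y) : ψ z = 0 := by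
  by_contra hne
  have hzpos : 0 < ψ z := (h.nonneg z).lt_of_ne' hne
  obtain ⟨m, hm, hmax⟩ := isCompact_Icc.exists_isMaxOn ⟨z, hz⟩ h.continuous.continuousOn
  have hmpos : 0 < ψ m := hzpos.trans_le (hmax hz)
  have hm1 : x < m := hm.1.lt_of_ne fun e => by rw [e] at hx; exact hmpos.ne' hx
  have hm2 : m < y := hm.2.lt_of_ne fun e => by rw [← e] at hy; exact hmpos.ne' hy
  have hloc : IsLocalMax ψ m := hmax.isLocalMax (Icc_mem_nhds hm1 hm2)
  have hd := hloc.deriv_eq_zero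
  have heq := h.equation m hmpos
  have hsrc : 0 < γ * ψ m ^ (γ - 1) := mul_pos hγ.1 (Real.rpow_pos_of_pos hmpos _)
  rw [hd, mul_zero, zero_add] at heq
  have hmin := isLocalMin_of_deriv_deriv_pos (heq ▸ hsrc) hd h.continuous.continuousAt
  -- A local maximum that is also a local minimum makes `ψ` locally constant, contradicting the
  -- positive second derivative.
  have hconst : ψ =ᶠ[𝓝 m] fun _ => ψ m := by
    filter_upwards [hloc, hmin] with s h1 h2 using le_antisymm h1 h2
  have := hconst.deriv.deriv_eq
  simp at this
  linarith

/-- If the zeros are bounded above, the last one starts a half profile; if not, order connectedness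
makes `ψ` vanish to the right of any zero. -/
theorem exists_right_part (hγ : γ ∈ Ioc (0 : ℝ) 1) (h : IsAdmissible γ c ψ)
    (hφ : IsHalfProfile γ c φ) :
    ∃ a p : ℝ, (a = 0 ∨ a = 1) ∧ ψ p = 0 ∧ ∀ ξ ≥ p, ψ ξ = a * φ (ξ - p) := by
  have hne : {ξ | ψ ξ = 0}.Nonempty := h.exists_zero
  have hcl : IsClosed {ξ | ψ ξ = 0} := isClosed_eq h.continuous continuous_const
  by_cases hb : BddAbove {ξ | ψ ξ = 0}
  · set p := sSup {ξ | ψ ξ = 0}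
    have hp : ψ p = 0 := hcl.csSup_mem hne hb
    have hh := h.isHalfProfile hp fun ξ hξ =>
      (h.nonneg ξ).lt_of_ne' fun h0 => (le_csSup hb h0).not_gt hξ
    refine ⟨1, p, Or.inr rfl, hp, fun ξ hξ => ?_⟩
    rw [one_mul, ← hh.unique hγ hφ (sub_nonneg.2 hξ), sub_add_cancel]
  · obtain ⟨p, hp⟩ := hne
    refine ⟨0, p, Or.inl rfl, hp, fun ξ hξ => ?_⟩
    obtain ⟨y, hy, hξy⟩ := not_bddAbove_iff.1 hb ξ
    rw [zero_mul]
    exact h.eq_zero_of_mem_Icc hγ hp hy ⟨hξ, hξy.le⟩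

theorem exists_decomposition (hγ : γ ∈ Ioc (0 : ℝ) 1) (h : IsAdmissible γ c ψ) {φp φm : ℝ → ℝ}
    (hp : IsHalfProfile γ c φp) (hp0 : ∀ ξ ≤ 0, φp ξ = 0)
    (hm : IsHalfProfile γ (-c) φm) (hm0 : ∀ ξ ≤ 0, φm ξ = 0) :
    ∃ a b ξp ξm : ℝ, (a = 0 ∨ a = 1) ∧ (b = 0 ∨ b = 1) ∧ a ^ 2 + b ^ 2 ≠ 0 ∧ ξm ≤ ξp ∧
      ∀ ξ, ψ ξ = a * φp (ξ - ξp) + b * φm (-(ξ - ξm)) := by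
  obtain ⟨a, p, ha, hψp, hright⟩ := h.exists_right_part hγ hp
  obtain ⟨b, q', hb, hψq, hleft'⟩ := h.comp_neg.exists_right_part hγ hm
  obtain ⟨q, rfl⟩ : ∃ q, q' = -q := ⟨-q', by simp⟩
  rw [neg_neg] at hψq
  have hleft : ∀ ξ ≤ q, ψ ξ = b * φm (-(ξ - q)) := fun ξ hξ => by
    have := hleft' (-ξ) (neg_le_neg hξ)
    rwa [neg_neg, show -ξ - -q = -(ξ - q) by ring] at this
  -- If `p < q`, then `ψ q = 0` together with positivity of `φp` forces `a = 0`, and the right edge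
  -- may be moved to `q`.
  obtain ⟨p, hψp, hright, hqp⟩ : ∃ p, ψ p = 0 ∧ (∀ ξ ≥ p, ψ ξ = a * φp (ξ - p)) ∧ q ≤ p := by
    rcases le_or_gt q p with hqp | hpq
    · exact ⟨p, hψp, hright, hqp⟩
    · have h1 := hright q hpq.le
      rw [hψq, eq_comm, mul_eq_zero] at h1
      have ha0 : a = 0 := h1.resolve_right (hp.pos _ (sub_pos.2 hpq)).ne'
      refine ⟨q, hψq, fun ξ hξ => ?_, le_rfl⟩
      rw [hright ξ (hpq.le.trans hξ), ha0, zero_mul, zero_mul]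
  have heq : ∀ ξ, ψ ξ = a * φp (ξ - p) + b * φm (-(ξ - q)) := fun ξ => by
    rcases le_total p ξ with h1 | h1
    · rw [hright ξ h1, hm0 (-(ξ - q)) (by linarith), mul_zero, add_zero]
    · rw [hp0 (ξ - p) (by linarith), mul_zero, zero_add]
      rcases le_total ξ q with h2 | h2
      · exact hleft ξ h2
      · rw [h.eq_zero_of_mem_Icc hγ hψq hψp ⟨h2, h1⟩, hm0 _ (by linarith), mul_zero]
  refine ⟨a, b, p, q, ha, hb, fun h0 => ?_, hqp, heq⟩
  have ha0 : a = 0 := by nlinarith [sq_nonneg a, sq_nonneg b]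
  have hb0 : b = 0 := by nlinarith [sq_nonneg a, sq_nonneg b]
  obtain ⟨ξ, hξ⟩ := h.exists_pos
  rw [heq ξ, ha0, hb0] at hξ
  simp at hξ

end IsAdmissible

/-! ### Existence, reflection and the main theorem -/

theorem exists_isHalfProfile (hγ : γ ∈ Ioc (0 : ℝ) 1) (c : ℝ) :
    ∃ φ, IsHalfProfile γ c φ ∧ ∀ ξ ≤ 0, φ ξ = 0 := by
  obtain ⟨φ, h0, h⟩ := exists_isMild_forall hγ c
  exact ⟨φ, isHalfProfile_of_isMild hγ h (h0 0 le_rfl), h0⟩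

theorem IsHalfProfile.eq_model (hγ : γ ∈ Ioc (0 : ℝ) 1) (h : IsHalfProfile γ 0 φ)
    (h0 : ∀ ξ ≤ 0, φ ξ = 0) (ξ : ℝ) : φ ξ = cBeta γ * (max ξ 0) ^ betaExp γ := by
  rcases le_or_gt ξ 0 with hξ | hξ
  · rw [h0 ξ hξ, max_eq_right hξ, Real.zero_rpow (betaExp_pos hγ).ne', mul_zero]
  · rw [max_eq_left hξ.le]
    exact (h.isMild hγ ξ).unique hγ (isMild_model hγ ξ) ⟨hξ, le_rfl⟩

theorem IsLeftward.comp_neg (h : IsLeftward ψ) : IsRightward fun x => ψ (-x) :=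
  ⟨fun ξ hξ => h.1 (-ξ) (by linarith), fun ξ hξ => by
    rw [deriv_comp_neg]; linarith [h.2 (-ξ) (by linarith)]⟩

theorem IsRightward.comp_neg (h : IsRightward ψ) : IsLeftward fun x => ψ (-x) :=
  ⟨fun ξ hξ => h.1 (-ξ) (by linarith), fun ξ hξ => by
    rw [deriv_comp_neg]; linarith [h.2 (-ξ) (by linarith)]⟩

end TravelingWave

theorem mainTheorem4 (γ : ℝ) (hγ : γ ∈ Set.Ioc (0 : ℝ) 1) (c : ℝ) :
    ∃ φp φm : ℝ → ℝ,
      -- the right-supported profile and its growth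
      (TravelingWave.IsAdmissible γ c φp ∧ TravelingWave.IsRightward φp ∧
        Tendsto φp atTop atTop ∧
        (c = 0 → ∀ ξ, φp ξ = TravelingWave.cBeta γ * (max ξ 0) ^ TravelingWave.betaExp γ) ∧
        (0 < c → φp ~[atTop] fun ξ =>
          (2 * γ / (TravelingWave.betaExp γ * c) * ξ) ^ (TravelingWave.betaExp γ / 2)) ∧
        (c < 0 → ∃ A > 0, φp ~[atTop] fun ξ => A * Real.exp (-c * ξ))) ∧
      -- the left-supported profile and its growth
      (TravelingWave.IsAdmissible γ c φm ∧ TravelingWave.IsLeftward φm ∧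
        Tendsto φm atBot atTop ∧
        (c = 0 → ∀ ξ, φm ξ = TravelingWave.cBeta γ * (max (-ξ) 0) ^ TravelingWave.betaExp γ) ∧
        (0 < c → ∃ A > 0, φm ~[atBot] fun ξ => A * Real.exp (-c * ξ)) ∧
        (c < 0 → φm ~[atBot] fun ξ =>
          (2 * γ / (TravelingWave.betaExp γ * |c|) * |ξ|) ^ (TravelingWave.betaExp γ / 2))) ∧
      -- these are the only two such profiles
      (∀ ψ, TravelingWave.IsAdmissible γ c ψ → TravelingWave.IsRightward ψ → ψ = φp) ∧
      (∀ ψ, TravelingWave.IsAdmissible γ c ψ → TravelingWave.IsLeftward ψ → ψ = φm) ∧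
      -- classification of all admissible profiles
      (∀ ψ, TravelingWave.IsAdmissible γ c ψ →
        ∃ a b ξp ξm : ℝ, (a = 0 ∨ a = 1) ∧ (b = 0 ∨ b = 1) ∧ a ^ 2 + b ^ 2 ≠ 0 ∧ ξm ≤ ξp ∧
          ∀ ξ, ψ ξ = a * φp (ξ - ξp) + b * φm (ξ - ξm)) := by
  obtain ⟨φp, hp, hp0⟩ := TravelingWave.exists_isHalfProfile hγ c
  -- The left profile is the reflection of the right one with the opposite speed.
  obtain ⟨φm, hm, hm0⟩ := TravelingWave.exists_isHalfProfile hγ (-c)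
  refine ⟨φp, fun x => φm (-x),
    ⟨hp.isAdmissible hp0, hp.isRightward hγ hp0, hp.tendsto_atTop hγ, ?_,
      hp.isEquivalent_rpow hγ, hp.isEquivalent_exp hγ⟩,
    ⟨?_, (hm.isRightward hγ hm0).comp_neg, (hm.tendsto_atTop hγ).comp tendsto_neg_atBot_atTop,
      ?_, ?_, ?_⟩,
    fun ψ h hr => h.eq_of_isRightward hγ hr hp hp0, fun ψ h hl => ?_,
    fun ψ h => h.exists_decomposition hγ hp hp0 hm hm0⟩
  · rintro rfl
    exact hp.eq_model hγ hp0
  · simpa using (hm.isAdmissible hm0).comp_neg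
  · rintro rfl ξ
    rw [neg_zero] at hm
    exact hm.eq_model hγ hm0 (-ξ)
  · intro hc
    obtain ⟨A, hA, hequiv⟩ := hm.isEquivalent_exp hγ (neg_neg_of_pos hc)
    refine ⟨A, hA, ?_⟩
    have := hequiv.comp_tendsto tendsto_neg_atBot_atTop
    refine this.trans_eventuallyEq (Eventually.of_forall fun ξ => ?_)
    simp
  · intro hc
    have := (hm.isEquivalent_rpow hγ (neg_pos.2 hc)).comp_tendsto tendsto_neg_atBot_atTop
    refine this.trans_eventuallyEq ?_
    filter_upwards [eventually_le_atBot 0] with ξ hξ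
    simp [abs_of_neg hc, abs_of_nonpos hξ]
  · have := h.comp_neg.eq_of_isRightward hγ hl.comp_neg hm hm0
    ext ξ
    simpa using congrFun this (-ξ)
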